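/- Let $p$ be a prime, $m,s\ge 1$ integers, and let $R=GR(p^2,m)$ be the Galois ring of characteristic $p^2$ with $p^{2m}$ elements, i.e. the finite commutative local ring of characteristic $p^2$ with $p^{2m}$ elements whose maximal ideal is $\langle p\rangle$; its residue field is $\mathbb F_{p^m}$. Let $\mathcal T_m\subset R$ be the Teichmüller set ($0$ together with the $(p^m-1)$-th roots of unity). Cyclic codes of length $p^s$ over $R$ (or $\mathbb F_{p^m}$) are the ideals of $R[x]/\langle x^{p^s}-1\rangle$ (or $\mathbb F_{p^m}[x]/\langle x^{p^s}-1\rangle$). The Hamming distance $d_H$ of a nonzero code is the least number of nonzero coefficients of a nonzero codeword, codewords being written as polynomials of degree $<p^s$. Let $\mu$ be coefficientwise reduction modulo $p$. For an ideal $C$ and $i\in\{0,1\}$ put $\mathrm{Tor}_i(C)=\{\mu(v): p^iv\in C\}$; then $\mathrm{Tor}_i(C)=\langle (x-1)^{T_i(C)}\rangle$ for some $0\le T_i(C)\le p^s$, the $i$-th torsional degree of $C$. For $0\le i\le p-2$ let $\gamma_{ip^{s-1}}\in\mathcal T_m$ be the element congruent to $\frac1p\binom{p^s}{(i+1)p^{s-1}}$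 modulo $p$, and let $\gamma_j=0$ for all other $j\ge 0$. (Thus $x^{p^s}-1=(x-1)^{p^s}+p(x-1)^{p^{s-1}}\sum_j\gamma_j(x-1)^j$ in $R[x]$.) Throughout, $k,\ell,n$ are nonnegative integers less than $p^s$; $n<k$ whenever $k$ and $n$ both occur; and, whenever $\ell$ and $\delta$ occur, $\ell<k$ and $\delta=\sum_{j=0}^{k-1-\ell}\eta_j(x-1)^j$ with $\eta_j\in\mathcal T_m$, $\eta_0\ne 0$, where we put $\eta_j=0$ for $j\ge k-\ell$ and $z=\min(\{j:\gamma_j\neq\eta_j\}\cup\{p^s\})$. **Forms.** Every ideal $C$ of $R[x]/\langle x^{p^s}-1\rangle$ has one of the forms $\langle 0\rangle$, $\langle 1\rangle$, $\langle p(x-1)^n\rangle$, $\langle (x-1)^k\rangle$, $\langle (x-1)^k+p(x-1)^\ell\delta\rangle$, $\langle (x-1)^k,\,p(x-1)^n\rangle$, $\langle (x-1)^k+p(x-1)^\ell\delta,\,p(x-1)^n\rangle$. **Torsional degrees.** 1. If $C=\langle (x-1)^k\rangle$, then $T_0(C)=k$ and $T_1(C)=\min(k,p^{s-1})$. 2.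 If $C=\langle (x-1)^k+p(x-1)^\ell\delta\rangle$, then $T_0(C)=k$ and $T_1(C)=\min(k,p^{s-1},p^s-k+\ell)$ if $p^{s-1}\ne p^s-k+\ell$, while $T_1(C)=\min(k,p^{s-1}+z)$ if $p^{s-1}=p^s-k+\ell$. 3. If $C=\langle (x-1)^k,\,p(x-1)^n\rangle$, then $T_0(C)=k$ and $T_1(C)=\min(k,p^{s-1},n)$. 4. If $C=\langle (x-1)^k+p(x-1)^\ell\delta,\,p(x-1)^n\rangle$, then $T_0(C)=k$ and $T_1(C)=\min(k,p^{s-1},p^s-k+\ell,n)$ if $p^{s-1}\neq p^s-k+\ell$, while $T_1(C)=\min(k,p^{s-1}+z,n)$ if $p^{s-1}=p^s-k+\ell$. 5. If $C=\langle p(x-1)^n\rangle$, then $T_0(C)=p^s$ and $T_1(C)=n$. **Hamming distance.** For every nonzero ideal $C$, $d_H(C)=d_H(\langle (x-1)^{T_1(C)}\rangle)$, where the code on the right is over $\mathbb F_{p^m}$. Moreover, for $0\le i<p^s$, the distance $d_H(\langle (x-1)^i\rangle)$ over $\mathbb F_{p^m}$ is - $1$ if $i=0$; - $2$ if $1\le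 i\le p^{s-1}$; - $\beta+2$ if $\beta p^{s-1}+1\le i\le(\beta+1)p^{s-1}$ with $1\le\beta\le p-2$; - $(\tau+1)p^{r}$ if $p^s-p^{s-r}+(\tau-1)p^{s-r-1}+1\le i\le p^s-p^{s-r}+\tau p^{s-r-1}$ with $1\le\tau\le p-1$ and $1\le r\le s-1$. -/

import Mathlib

open Polynomial

/-- `R` is the Galois ring `GR(p^a, m)`: the (unique up to isomorphism) finite commutative local ring
of characteristic `p^a` with `p^(a m)` elements whose maximal ideal is generated by `p`. -/
structure IsGaloisRing (p a m : ℕ) (R : Type*) [CommRing R] [IsLocalRing R] : Prop where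
  charP : CharP R (p ^ a)
  maximalIdeal_eq : IsLocalRing.maximalIdeal R = Ideal.span {(p : R)}
  card_eq : Nat.card R = p ^ (a * m)

/-- The Teichmüller set `{0, 1, ζ, …, ζ^(p^m - 2)}` of `GR(p^a, m)`, where `ζ` is an element of
multiplicative order `p^m - 1`: zero together with the `(p^m - 1)`-th roots of unity. -/
def teichmullerSet (p m : ℕ) (R : Type*) [CommRing R] : Set R :=
  {r | r = 0 ∨ r ^ (p ^ m - 1) = 1}

/-- The Teichmüller representative of `r` modulo `p` in a Galois ring of characteristic `p^2`;
see `teichmullerRep_mem` and `residue_teichmullerRep`. -/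
def teichmullerRep (p m : ℕ) {R : Type*} [CommRing R] (r : R) : R := r ^ (p ^ m)

/-- The ring `R[x] / ⟨x^N - 1⟩`, whose ideals are the cyclic codes of length `N` over `R`. -/
abbrev CyclicAmbient (R : Type*) [CommRing R] (N : ℕ) : Type _ :=
  AdjoinRoot (X ^ N - 1 : R[X])

/-- The class of `x - 1` in `R[x] / ⟨x^N - 1⟩`. -/
noncomputable def xSubOne (R : Type*) [CommRing R] (N : ℕ) : CyclicAmbient R N :=
  AdjoinRoot.mk (X ^ N - 1 : R[X]) (X - 1)

/-- The Hamming distance of a cyclic code: the least number of nonzero coefficients of a nonzero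
codeword, codewords being identified with polynomials of degree less than `N`.
(For the zero code, which has no nonzero codeword, the value is `0` by convention.) -/
noncomputable def hammingDistance {R : Type*} [CommRing R] {N : ℕ}
    (C : Ideal (CyclicAmbient R N)) : ℕ :=
  sInf {w | ∃ f : R[X], f ≠ 0 ∧ f.degree < (N : WithBot ℕ) ∧
    AdjoinRoot.mk (X ^ N - 1 : R[X]) f ∈ C ∧ f.support.card = w}

/-- The canonical projection `μ`, which reduces the coefficients to the residue field. -/
noncomputable def reduction (R : Type*) [CommRing R] [IsLocalRing R] (N : ℕ) :
    CyclicAmbient R N →+* CyclicAmbient (IsLocalRing.ResidueField R) N :=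
  AdjoinRoot.map (IsLocalRing.residue R) _ _ (by simp)

/-- The `i`-th torsion code `Tor_i(C) = {μ(v) : p^i v ∈ C}`. -/
def torsionCode (p : ℕ) {R : Type*} [CommRing R] [IsLocalRing R] {N : ℕ} (i : ℕ)
    (C : Ideal (CyclicAmbient R N)) : Set (CyclicAmbient (IsLocalRing.ResidueField R) N) :=
  {w | ∃ v : CyclicAmbient R N, (p : CyclicAmbient R N) ^ i * v ∈ C ∧ reduction R N v = w}

/-- The `i`-th torsional degree `T_i(C)`: the exponent `T ≤ N` for which
`Tor_i(C) = ⟨(x - 1)^T⟩` (here `N` is a power of `p`). -/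
noncomputable def torsionalDegree (p : ℕ) {R : Type*} [CommRing R] [IsLocalRing R] {N : ℕ} (i : ℕ)
    (C : Ideal (CyclicAmbient R N)) : ℕ :=
  sInf {T | T ≤ N ∧ torsionCode p i C =
    (Ideal.span {xSubOne (IsLocalRing.ResidueField R) N ^ T} : Set _)}

/-- The coefficients `γ_j ∈ T_m` with
`x^(p^s) - 1 = (x-1)^(p^s) + p (x-1)^(p^(s-1)) ∑_j γ_j (x-1)^j` over `GR(p^2, m)`:
for `j = i p^(s-1)` with `0 ≤ i ≤ p - 2`, `γ_j` is the Teichmüller representative of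
`binom(p^s, (i+1) p^(s-1)) / p` modulo `p`; all other `γ_j` are zero. -/
def gammaCoeff (p m s : ℕ) (R : Type*) [CommRing R] (j : ℕ) : R :=
  if p ^ (s - 1) ∣ j ∧ j / p ^ (s - 1) + 2 ≤ p then
    teichmullerRep p m
      (((p ^ s).choose ((j / p ^ (s - 1) + 1) * p ^ (s - 1)) / p : ℕ) : R)
  else 0

/-- `η` is the coefficient sequence of some `δ = ∑_{j=0}^{k-1-l} η_j (x-1)^j`, with coefficients in
the Teichmüller set and `η_0 ≠ 0` (so that `l < k`). Coefficients outside the range are zero. -/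
structure IsDeltaCoeff (p m k l : ℕ) {R : Type*} [CommRing R] (η : ℕ → R) : Prop where
  lt : l < k
  mem : ∀ j, η j ∈ teichmullerSet p m R
  zero_ne : η 0 ≠ 0
  eq_zero : ∀ j, k - l ≤ j → η j = 0

/-- `δ = ∑_{j=0}^{k-1-l} η_j (x-1)^j`. -/
noncomputable def deltaPoly {R : Type*} [CommRing R] (N k l : ℕ) (η : ℕ → R) :
    CyclicAmbient R N :=
  ∑ j ∈ Finset.range (k - l), AdjoinRoot.of (X ^ N - 1 : R[X]) (η j) * xSubOne R N ^ j

/-- `z = min ({j | γ_j ≠ η_j} ∪ {p^s})`. -/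
noncomputable def firstDiff (p m s : ℕ) {R : Type*} [CommRing R] (η : ℕ → R) : ℕ :=
  sInf ({j | gammaCoeff p m s R j ≠ η j} ∪ {p ^ s})

section Helpers

variable {p m : ℕ} {R : Type*} [CommRing R] [IsLocalRing R]

theorem IsGaloisRing.p_sq (h : IsGaloisRing p 2 m R) : (p : R) * p = 0 := by
  have := h.charP
  have h2 := CharP.cast_eq_zero R (p ^ 2)
  rw [← h2]; push_cast; ring

theorem IsGaloisRing.card_residueField (h : IsGaloisRing p 2 m R) (hp : p.Prime) :
    Nat.card (IsLocalRing.ResidueField R) = p ^ m := by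
  have hch := h.charP
  have hp0 : (p : R) ≠ 0 := by
    intro h0
    have := (CharP.cast_eq_zero_iff R (p ^ 2) p).1 h0
    have := Nat.le_of_dvd hp.pos this
    nlinarith [hp.two_le]
  let f : R →ₗ[R] R := LinearMap.mulLeft R (p : R)
  have hker : LinearMap.ker f = IsLocalRing.maximalIdeal R := by
    ext r
    simp only [LinearMap.mem_ker, f, LinearMap.mulLeft_apply]
    constructor
    · intro hr
      rw [IsLocalRing.mem_maximalIdeal]
      intro hu
      exact hp0 ((hu.mul_left_eq_zero).1 hr)
    · intro hr
      rw [h.maximalIdeal_eq, Ideal.mem_span_singleton'] at hr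
      obtain ⟨a, rfl⟩ := hr
      rw [mul_left_comm, h.p_sq, mul_zero]
  have hran : LinearMap.range f = IsLocalRing.maximalIdeal R := by
    ext r
    rw [h.maximalIdeal_eq, Ideal.mem_span_singleton']
    simp only [LinearMap.mem_range, f, LinearMap.mulLeft_apply, mul_comm]
  have e := f.quotKerEquivRange
  have h1 : Nat.card (R ⧸ IsLocalRing.maximalIdeal R) = Nat.card (IsLocalRing.maximalIdeal R) := by
    rw [hker, hran] at e
    exact Nat.card_congr e.toEquiv
  have h2 := Submodule.card_eq_card_quotient_mul_card (IsLocalRing.maximalIdeal R)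
  rw [h.card_eq, ← h1] at h2
  have h3 : (p ^ m) ^ 2 = (Nat.card (R ⧸ IsLocalRing.maximalIdeal R)) ^ 2 := by
    rw [sq (Nat.card _)]
    rw [← pow_mul, mul_comm]
    exact h2
  exact (Nat.pow_left_injective (n := 2) (by norm_num) h3).symm

theorem residue_teichmullerRep (h : IsGaloisRing p 2 m R) (hp : p.Prime) (r : R) :
    IsLocalRing.residue R (teichmullerRep p m r) = IsLocalRing.residue R r := by
  have hc := h.card_residueField hp
  have : Finite (IsLocalRing.ResidueField R) :=
    Nat.finite_of_card_ne_zero (by rw [hc]; exact (pow_pos hp.pos m).ne')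
  have := Fintype.ofFinite (IsLocalRing.ResidueField R)
  rw [teichmullerRep, map_pow, ← hc, Nat.card_eq_fintype_card, FiniteField.pow_card]

theorem teichmullerRep_mem (h : IsGaloisRing p 2 m R) (hp : p.Prime) (r : R) :
    teichmullerRep p m r ∈ teichmullerSet p m R := by
  have hc := h.card_residueField hp
  have hfin : Finite (IsLocalRing.ResidueField R) :=
    Nat.finite_of_card_ne_zero (by rw [hc]; exact (pow_pos hp.pos m).ne')
  have := Fintype.ofFinite (IsLocalRing.ResidueField R)
  have hm : m ≠ 0 := by
    rintro rfl
    have h1 := Finite.one_lt_card (α := IsLocalRing.ResidueField R)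
    rw [hc, pow_zero] at h1
    exact absurd h1 (lt_irrefl 1)
  have h2 : 2 ≤ p ^ m := hp.two_le.trans (Nat.le_self_pow hm p)
  have hpq : (p : R) * ((p ^ m : ℕ) : R) = 0 := by
    obtain ⟨n, rfl⟩ := Nat.exists_eq_succ_of_ne_zero hm
    push_cast
    rw [pow_succ', ← mul_assoc, h.p_sq, zero_mul]
  by_cases hr : IsUnit r
  · right
    have h1 : r ^ (p ^ m - 1) - 1 ∈ IsLocalRing.maximalIdeal R := by
      rw [← IsLocalRing.residue_eq_zero_iff, map_sub, map_pow, map_one, sub_eq_zero, ← hc,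
        Nat.card_eq_fintype_card]
      exact FiniteField.pow_card_sub_one_eq_one _ (hr.map (IsLocalRing.residue R)).ne_zero
    rw [h.maximalIdeal_eq, Ideal.mem_span_singleton'] at h1
    obtain ⟨a, ha⟩ := h1
    have h3 : r ^ (p ^ m - 1) = 1 + a * p := by rw [ha]; ring
    rw [teichmullerRep, pow_right_comm, h3]
    obtain ⟨k, hk⟩ := Nat.exists_eq_add_of_le h2
    have key : ∀ n : ℕ, (1 + a * (p : R)) ^ n = 1 + n * (a * p) := by
      intro n
      induction n with
      | zero => simp
      | succ n ih =>
        rw [pow_succ, ih]; push_cast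
        linear_combination (n * a ^ 2 : R) * h.p_sq
    rw [key]
    linear_combination a * hpq
  · left
    have h1 : r ∈ IsLocalRing.maximalIdeal R := hr
    rw [h.maximalIdeal_eq, Ideal.mem_span_singleton'] at h1
    obtain ⟨a, rfl⟩ := h1
    rw [teichmullerRep]
    refine pow_eq_zero_of_le h2 ?_
    linear_combination a ^ 2 * h.p_sq

end Helpers

/-! Write u = x - 1 and N = p^s. Over the residue field x^N - 1 = u^N, so every ideal of the ambient
ring is some ⟨u^T⟩; in particular every torsion code is. Over R, expanding (1 + u)^N = 1 and using
Kummer's theorem, v_p(binom(p^s, j)) = s - v_p(j), gives u^N = -p u^(p^(s-1)) Γ, where Γ = ∑ γ_j u^j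
is a unit modulo p because γ_0 is (`IsGaloisRing.xSubOne_pow_self`,
`IsGaloisRing.isUnit_residueGammaSum`).

Torsional degrees: a combination b(u^k + p a) + c p g is divisible by p exactly when u^k b vanishes
modulo p, that is, when b is a multiple of u^(N-k) modulo p. As u^(N-k)(u^k + p a) = p(u^(N-k) a -
u^(p^(s-1)) Γ), the code Tor_1 of ⟨u^k + p a, p g⟩ is generated by u^k, the bracket and g
(`IsGaloisRing.torsionCode_one_span_pair`). For a = u^ℓ δ the bracket is a difference of two powers
of u times units. If the exponents differ, the smaller one wins; if they agree, the factor δ - Γ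
contributes u^z times a unit.

Distance: multiplication by p carries Tor_1(C) into C without changing weights, and a codeword that
survives reduction lands in Tor_1(C) with no larger weight (`IsGaloisRing.hammingDistance_eq`). Over
the residue field the lower bound comes from sorting exponents by residue modulo p^t, which trades a
polynomial of degree below p^(t+1) for one of degree below p^t at a controlled loss of weight
(`exists_reduced_weight`). The power of x - 1 at the end of each block of exponents attains the
bound. -/

/-! ### Weights of multiples of (x - 1)^i in characteristic p -/

section Weight

variable {F : Type*} [Field F]

/-- Induction on b: the operator X d/dX - k deletes the exponent k from the support and costs one
factor X - 1. Since all exponents are below p they are distinct in F, so the result is zero only for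
a monomial, which does not vanish at 1. -/
theorem succ_le_card_support_of_pow_dvd {p : ℕ} [CharP F p] (b : ℕ) :
    ∀ f : F[X], f ≠ 0 → f.natDegree < p → (X - 1) ^ b ∣ f → b + 1 ≤ f.support.card := by
  induction b with
  | zero =>
    intro f hf _ _
    exact Finset.card_pos.2 (Polynomial.support_nonempty.2 hf)
  | succ b ih =>
    intro f hf hdeg hdvd
    obtain ⟨k, hk⟩ := Polynomial.support_nonempty.2 hf
    set g : F[X] := X * derivative f - C (k : F) * f with hg
    have hcoeff : ∀ n, g.coeff n = ((n : F) - k) * f.coeff n := by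
      intro n
      cases n with
      | zero => simp [hg]
      | succ n =>
        simp only [hg, coeff_sub, coeff_X_mul, coeff_derivative, coeff_C_mul]
        push_cast; ring
    have hsub : g.support ⊆ f.support.erase k := by
      intro n hn
      rw [mem_support_iff, hcoeff] at hn
      rw [Finset.mem_erase, mem_support_iff]
      refine ⟨?_, right_ne_zero_of_mul hn⟩
      rintro rfl
      simp at hn
    have hgd : (X - 1) ^ b ∣ g := by
      have h1 : (X - 1 : F[X]) ^ b ∣ derivative f := by
        obtain ⟨c, rfl⟩ := hdvd
        rw [derivative_mul, derivative_pow]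
        refine dvd_add ?_ ?_
        · simp only [Nat.add_sub_cancel]
          exact Dvd.dvd.mul_right (Dvd.dvd.mul_right (Dvd.intro_left _ rfl) _) _
        · exact Dvd.dvd.mul_right (pow_dvd_pow _ (Nat.le_succ b)) _
      exact dvd_sub (Dvd.dvd.mul_left h1 _)
        (Dvd.dvd.mul_left ((pow_dvd_pow _ (Nat.le_succ b)).trans hdvd) _)
    have hg0 : g ≠ 0 := by
      intro h0
      have hmono : f = monomial k (f.coeff k) := by
        ext n
        rw [coeff_monomial]
        split_ifs with h
        · rw [h]
        · by_contra hn
          have h2 := hcoeff n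
          rw [h0, coeff_zero] at h2
          rcases mul_eq_zero.1 h2.symm with h3 | h3
          · have hlt : ∀ j ∈ f.support, j < p := fun j hj =>
              (le_natDegree_of_mem_supp j hj).trans_lt hdeg
            have h4 := (CharP.natCast_eq_natCast F p).1 (sub_eq_zero.1 h3 : (n : F) = k)
            exact h (Nat.ModEq.eq_of_lt_of_lt h4 (hlt n (mem_support_iff.2 hn)) (hlt k hk)).symm
          · exact hn h3
      have h1 : f.eval 1 = 0 := by
        obtain ⟨c, hc⟩ := hdvd
        rw [hc]; simp
      rw [hmono] at h1
      simp at h1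
      exact (mem_support_iff.1 hk) h1
    have hgdeg : g.natDegree < p := by
      refine lt_of_le_of_lt ?_ hdeg
      exact le_natDegree_of_mem_supp _
        (Finset.mem_of_mem_erase (hsub (natDegree_mem_support_of_nonzero hg0)))
    have h5 := ih g hg0 hgdeg hgd
    have h6 := Finset.card_le_card hsub
    have h7 := Finset.card_erase_add_one hk
    omega

/-- The part of `f` supported on the exponents congruent to `c` modulo `q`, as a polynomial in
`X ^ q`; only exponents below `p * q` are retained. -/
noncomputable def residueSlice (p q c : ℕ) (f : F[X]) : F[X] :=
  ∑ a ∈ Finset.range p, monomial a (f.coeff (a * q + c))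

theorem coeff_residueSlice {p q c : ℕ} {f : F[X]} (hc : f.degree < (p * q : ℕ)) (a : ℕ) :
    (residueSlice p q c f).coeff a = f.coeff (a * q + c) := by
  simp only [residueSlice, finsetSum_coeff, coeff_monomial]
  rw [Finset.sum_ite_eq']
  split_ifs with h
  · rfl
  · symm
    apply coeff_eq_zero_of_degree_lt
    refine hc.trans_le ?_
    rw [Finset.mem_range, not_lt] at h
    exact_mod_cast (Nat.mul_le_mul_right q h).trans (Nat.le_add_right _ _)

theorem degree_residueSlice_lt (p q c : ℕ) (f : F[X]) : (residueSlice p q c f).degree < p := by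
  rw [degree_lt_iff_coeff_zero]
  intro m hm
  simp only [residueSlice, finsetSum_coeff, coeff_monomial]
  rw [Finset.sum_ite_eq', if_neg (by simpa using hm)]

theorem sum_X_pow_mul_expand_residueSlice {p q : ℕ} (hq : 0 < q) {f : F[X]}
    (hf : f.degree < (p * q : ℕ)) :
    ∑ c ∈ Finset.range q, X ^ c * expand F q (residueSlice p q c f) = f := by
  ext n
  rw [finsetSum_coeff, Finset.sum_eq_single (n % q)]
  · rw [coeff_X_pow_mul', if_pos (Nat.mod_le _ _), coeff_expand hq,
      if_pos (Nat.dvd_sub_mod n), coeff_residueSlice hf]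
    congr 1
    have := Nat.div_mul_cancel (Nat.dvd_sub_mod (n := q) n)
    rw [this]
    exact Nat.sub_add_cancel (Nat.mod_le _ _)
  · intro c hc hne
    rw [coeff_X_pow_mul']
    split_ifs with h
    · rw [coeff_expand hq, if_neg]
      intro hd
      apply hne
      have := (Nat.modEq_iff_dvd' h).2 hd
      rw [← this]
      exact (Nat.mod_eq_of_lt (Finset.mem_range.1 hc)).symm
    · rfl
  · intro h
    exact absurd (Finset.mem_range.2 (Nat.mod_lt _ hq)) h

theorem card_support_eq_sum_residueSlice {p q : ℕ} (hq : 0 < q) {f : F[X]}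
    (hf : f.degree < (p * q : ℕ)) :
    f.support.card = ∑ c ∈ Finset.range q, (residueSlice p q c f).support.card := by
  rw [Finset.card_eq_sum_card_fiberwise (f := fun n => n % q) (t := Finset.range q)
    (fun n _ => by simpa using Nat.mod_lt n hq)]
  refine Finset.sum_congr rfl fun c hc => ?_
  symm
  refine Finset.card_bij (fun a _ => a * q + c) ?_ ?_ ?_
  · intro a ha
    rw [mem_support_iff, coeff_residueSlice hf] at ha
    simp only [Finset.mem_filter, mem_support_iff]
    exact ⟨ha, by rw [mul_comm, Nat.mul_add_mod, Nat.mod_eq_of_lt (Finset.mem_range.1 hc)]⟩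
  · intro a _ b _ h
    exact Nat.eq_of_mul_eq_mul_right hq (Nat.add_right_cancel h)
  · intro n hn
    simp only [Finset.mem_filter, mem_support_iff] at hn
    have h1 : n / q * q + c = n := by rw [← hn.2]; exact Nat.div_add_mod' n q
    exact ⟨n / q, by rw [mem_support_iff, coeff_residueSlice hf, h1]; exact hn.1, h1⟩

theorem X_sub_one_pow_char_pow (p : ℕ) [Fact p.Prime] [CharP F p] (t : ℕ) :
    (X - 1 : F[X]) ^ p ^ t = X ^ p ^ t - 1 := by
  rw [sub_pow_char_pow, one_pow]

theorem degree_X_sub_one : (X - 1 : F[X]).degree = 1 := by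
  rw [← C_1]; exact degree_X_sub_C 1

theorem le_natDegree_of_X_sub_one_pow_dvd {f : F[X]} (hf : f ≠ 0) {i : ℕ}
    (h : (X - 1) ^ i ∣ f) : i ≤ f.natDegree := by
  have := natDegree_le_of_dvd h hf
  rwa [natDegree_pow, ← C_1, natDegree_X_sub_C, mul_one] at this

/-- With q = p^t, write f = ∑ X^c f_c(X^q) and let (X - 1)^b be the largest power dividing every
slice, f_c = (X - 1)^b g_c. As X^q - 1 = (X - 1)^q, this gives f = (X - 1)^(bq) G with G congruent
to h = ∑ g_c(1) X^c modulo (X - 1)^q. So h inherits the remaining factors X - 1, and every c in its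
support marks a nonzero slice, of weight at least b + 1. -/
theorem exists_reduced_weight {p : ℕ} [Fact p.Prime] [CharP F p] {t i : ℕ} {f : F[X]}
    (hf : f ≠ 0) (hdeg : f.degree < (p ^ (t + 1) : ℕ)) (hdvd : (X - 1) ^ i ∣ f) :
    ∃ (b r : ℕ) (h : F[X]), b < p ∧ r < p ^ t ∧ i ≤ b * p ^ t + r ∧ h ≠ 0 ∧
      h.degree < (p ^ t : ℕ) ∧ (X - 1) ^ r ∣ h ∧ (b + 1) * h.support.card ≤ f.support.card := by
  have hp : p.Prime := Fact.out
  set q := p ^ t with hq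
  have hq0 : 0 < q := pow_pos hp.pos t
  rw [pow_succ, ← hq, mul_comm] at hdeg
  have hsum := sum_X_pow_mul_expand_residueSlice hq0 hdeg
  -- A nonzero slice is not divisible by a power of X - 1 beyond its own degree, so a maximal b
  -- exists.
  have hex : ∃ b, ¬ ∀ c ∈ Finset.range q, (X - 1) ^ (b + 1) ∣ residueSlice p q c f := by
    by_contra! hall
    apply hf
    rw [← hsum]
    refine Finset.sum_eq_zero fun c hc => ?_
    by_cases h0 : residueSlice p q c f = 0
    · simp [h0]
    · have := le_natDegree_of_X_sub_one_pow_dvd h0 (hall (residueSlice p q c f).natDegree c hc)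
      omega
  classical
  obtain ⟨b, hb, hall⟩ : ∃ b, (¬ ∀ c ∈ Finset.range q, (X - 1) ^ (b + 1) ∣ residueSlice p q c f) ∧
      ∀ c ∈ Finset.range q, (X - 1) ^ b ∣ residueSlice p q c f := by
    refine ⟨Nat.find hex, Nat.find_spec hex, ?_⟩
    rcases hn : Nat.find hex with _ | n
    · simp
    · have := Nat.find_min hex (m := n) (by omega)
      push Not at this
      exact this
  choose! g hg using hall
  set h : F[X] := ∑ c ∈ Finset.range q, monomial c ((g c).eval 1) with hh
  have hcoeff : ∀ c, h.coeff c = if c < q then (g c).eval 1 else 0 := by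
    intro c
    simp only [hh, finsetSum_coeff, coeff_monomial]
    rw [Finset.sum_ite_eq']; simp
  have hhdeg : h.degree < (q : ℕ) := by
    rw [degree_lt_iff_coeff_zero]
    intro m hm
    rw [hcoeff, if_neg (by omega)]
  push Not at hb
  obtain ⟨c, hc, hcn⟩ := hb
  have hgc : (g c).eval 1 ≠ 0 := by
    intro h0
    apply hcn
    rw [hg c hc, pow_succ]
    refine mul_dvd_mul_left _ ?_
    rw [← C_1, dvd_iff_isRoot]; exact h0
  have hh0 : h ≠ 0 := by
    intro h0
    have := hcoeff c
    rw [h0, if_pos (Finset.mem_range.1 hc), coeff_zero] at this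
    exact hgc this.symm
  have hbp : b < p := by
    have h0 : residueSlice p q c f ≠ 0 := by
      intro h0; rw [h0] at hcn; simp at hcn
    have h1 := le_natDegree_of_X_sub_one_pow_dvd h0 ⟨_, hg c hc⟩
    have h2 := (natDegree_lt_iff_degree_lt h0).2 (degree_residueSlice_lt p q c f)
    omega
  set G : F[X] := ∑ c ∈ Finset.range q, X ^ c * expand F q (g c) with hG
  have hfrob : (X - 1 : F[X]) ^ q = X ^ q - 1 := X_sub_one_pow_char_pow p t
  have hfG : f = (X - 1) ^ (b * q) * G := by
    rw [← hsum, hG, Finset.mul_sum]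
    refine Finset.sum_congr rfl fun c hc => ?_
    rw [hg c hc, map_mul, map_pow, map_sub, expand_X, map_one, ← hfrob, ← pow_mul, mul_comm q]
    ring
  have hGh : (X - 1) ^ q ∣ G - h := by
    rw [hG, hh, ← Finset.sum_sub_distrib]
    refine Finset.dvd_sum fun c hc => ?_
    have h1 : (X - 1 : F[X]) ∣ g c - C ((g c).eval 1) := by
      rw [← C_1]; exact X_sub_C_dvd_sub_C_eval
    have h2 := map_dvd (expand F q) h1
    rw [map_sub, map_sub, expand_X, map_one, expand_C, ← hfrob] at h2
    rw [← C_mul_X_pow_eq_monomial, mul_comm (C _), ← mul_sub]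
    exact Dvd.dvd.mul_left h2 _
  have hne : (X - 1 : F[X]) ≠ 0 := by
    rw [← C_1]; exact X_sub_C_ne_zero 1
  have hGr : (X - 1) ^ (i - b * q) ∣ G := by
    rcases le_total i (b * q) with hle | hle
    · rw [Nat.sub_eq_zero_of_le hle]; simp
    · rw [hfG, ← Nat.add_sub_cancel' hle, pow_add] at hdvd
      have := (mul_dvd_mul_iff_left (pow_ne_zero _ hne)).1 hdvd
      simpa using this
  have hr : i - b * q < q := by
    -- Otherwise (X - 1)^q would divide h, which is nonzero of degree below q.
    by_contra! hle
    have h1 := (pow_dvd_pow (X - 1 : F[X]) hle).trans hGr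
    have h2 : (X - 1) ^ q ∣ h := by
      have := dvd_sub h1 hGh
      simpa using this
    have h3 := le_natDegree_of_X_sub_one_pow_dvd hh0 h2
    have h4 := (natDegree_lt_iff_degree_lt hh0).2 hhdeg
    omega
  refine ⟨b, i - b * q, h, hbp, hr, by omega, hh0, hhdeg, ?_, ?_⟩
  · have := dvd_sub hGr ((pow_dvd_pow _ hr.le).trans hGh)
    simpa using this
  · have hsub : h.support ⊆ Finset.range q := by
      intro c hc
      by_contra hn
      rw [mem_support_iff, hcoeff, if_neg (by simpa using hn)] at hc
      exact hc rfl
    rw [card_support_eq_sum_residueSlice hq0 hdeg, mul_comm, ← smul_eq_mul, ← Finset.sum_const]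
    refine (Finset.sum_le_sum fun c hc => ?_).trans (Finset.sum_le_sum_of_subset hsub)
    have hcq := hsub hc
    have h0 : residueSlice p q c f ≠ 0 := by
      rw [hg c hcq]
      refine mul_ne_zero (pow_ne_zero _ hne) ?_
      rintro h1
      rw [mem_support_iff, hcoeff, h1] at hc
      simp at hc
    exact succ_le_card_support_of_pow_dvd (p := p) b _ h0
      ((natDegree_lt_iff_degree_lt h0).2 (degree_residueSlice_lt p q c f)) ⟨_, hg c hcq⟩

theorem two_le_card_support {f : F[X]} (hf : f ≠ 0) (h : (X - 1) ∣ f) :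
    2 ≤ f.support.card := by
  by_contra! hlt
  obtain ⟨n, a, rfl⟩ := card_support_le_one_iff_monomial.1 (Nat.le_of_lt_succ hlt)
  rw [← C_1, dvd_iff_isRoot] at h
  simp at h
  exact hf (by simp [h])

/-- The reduction yields some b' ≥ b. If b' > b, the factor b' + 1 suffices; if b' = b, at least one
factor X - 1 is left for h, whose weight is then at least 2, and 2(b + 1) ≥ b + 2. -/
theorem add_two_le_card_support {p : ℕ} [Fact p.Prime] [CharP F p] {t b i : ℕ} {f : F[X]}
    (hf : f ≠ 0) (hdeg : f.degree < (p ^ (t + 1) : ℕ)) (hdvd : (X - 1) ^ i ∣ f)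
    (hi : b * p ^ t + 1 ≤ i) : b + 2 ≤ f.support.card := by
  obtain ⟨b', r, h, -, hr, hle, h0, -, hd, hw⟩ := exists_reduced_weight hf hdeg hdvd
  have hbb : b ≤ b' := by
    by_contra! hlt
    have := Nat.mul_le_mul_right (p ^ t) (Nat.succ_le_of_lt hlt)
    rw [Nat.succ_mul] at this
    omega
  have hcard : 1 ≤ h.support.card := Finset.card_pos.2 (support_nonempty.2 h0)
  rcases hbb.eq_or_lt with rfl | hlt
  · have h1 : (X - 1) ∣ h := (dvd_pow_self _ (by omega)).trans hd
    have h2 := two_le_card_support h0 h1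
    nlinarith
  · nlinarith

theorem exists_reduced_weight_iterate {p : ℕ} [Fact p.Prime] [CharP F p] {t j : ℕ} (k : ℕ) :
    ∀ f : F[X], f ≠ 0 → f.degree < (p ^ (t + k) : ℕ) →
      (X - 1) ^ (p ^ (t + k) - p ^ t + j) ∣ f →
      ∃ h : F[X], h ≠ 0 ∧ h.degree < (p ^ t : ℕ) ∧ (X - 1) ^ j ∣ h ∧
        p ^ k * h.support.card ≤ f.support.card := by
  have hp : p.Prime := Fact.out
  induction k with
  | zero =>
    intro f hf hdeg hd
    exact ⟨f, hf, hdeg, by simpa using hd, by simp⟩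
  | succ k ih =>
    intro f hf hdeg hd
    obtain ⟨b, r, h, hb, hr, hle, h0, hdeg', hd', hw⟩ := exists_reduced_weight (t := t + k) hf hdeg hd
    have h1 : p ^ t ≤ p ^ (t + k) := Nat.pow_le_pow_right hp.pos (Nat.le_add_right _ _)
    have h2 : p ^ (t + (k + 1)) = (p - 1) * p ^ (t + k) + p ^ (t + k) := by
      rw [← Nat.succ_mul, Nat.succ_eq_add_one, Nat.sub_add_cancel hp.one_le, ← add_assoc, pow_succ,
        mul_comm]
    -- The exponent is at least (p - 1)p^(t+k), which a smaller b together with r < p^(t+k) cannot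
    -- reach. Each round therefore gains the full factor p.
    have h3 : b = p - 1 := by
      by_contra hne
      have := Nat.mul_le_mul_right (p ^ (t + k)) (show b + 1 ≤ p - 1 by omega)
      rw [Nat.succ_mul] at this
      omega
    subst h3
    obtain ⟨h', h0', hdeg'', hd'', hw'⟩ := ih h h0 hdeg' ((pow_dvd_pow _ (by omega)).trans hd')
    refine ⟨h', h0', hdeg'', hd'', ?_⟩
    rw [Nat.sub_add_cancel hp.one_le] at hw
    calc p ^ (k + 1) * h'.support.card = p * (p ^ k * h'.support.card) := by ring
      _ ≤ p * h.support.card := Nat.mul_le_mul_left _ hw'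
      _ ≤ _ := hw

theorem mul_le_card_support {p : ℕ} [Fact p.Prime] [CharP F p] {t k b i : ℕ} {f : F[X]}
    (hf : f ≠ 0) (hdeg : f.degree < (p ^ (t + 1 + k) : ℕ)) (hdvd : (X - 1) ^ i ∣ f)
    (hi : p ^ (t + 1 + k) - p ^ (t + 1) + b * p ^ t + 1 ≤ i) :
    (b + 2) * p ^ k ≤ f.support.card := by
  obtain ⟨h, h0, hd, hdv, hw⟩ := exists_reduced_weight_iterate (j := b * p ^ t + 1) k f hf hdeg
    ((pow_dvd_pow _ (by omega)).trans hdvd)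
  have := add_two_le_card_support h0 hd hdv le_rfl
  rw [mul_comm]
  exact (Nat.mul_le_mul_left _ this).trans hw

theorem card_support_expand_le {q : ℕ} (hq : 0 < q) (g : F[X]) :
    (expand F q g).support.card ≤ g.support.card := by
  refine (Finset.card_le_card ?_).trans (Finset.card_image_le (f := fun n => n * q))
  intro n hn
  rw [mem_support_iff, coeff_expand hq] at hn
  split_ifs at hn with h
  · exact Finset.mem_image.2 ⟨n / q, mem_support_iff.2 hn, Nat.div_mul_cancel h⟩
  · exact absurd rfl hn

/-- By Frobenius this power is (Y - 1)^n evaluated at Y = X^(p^t). -/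
theorem card_support_X_sub_one_pow_le (p : ℕ) [Fact p.Prime] [CharP F p] (t n : ℕ) :
    ((X - 1 : F[X]) ^ (p ^ t * n)).support.card ≤ n + 1 := by
  have h1 : (X - 1 : F[X]) ^ (p ^ t * n) = expand F (p ^ t) ((X - 1) ^ n) := by
    rw [pow_mul, X_sub_one_pow_char_pow]; simp
  rw [h1]
  refine (card_support_expand_le (pow_pos (Fact.out : p.Prime).pos t) _).trans
    ((card_supp_le_succ_natDegree _).trans ?_)
  rw [natDegree_pow, ← C_1, natDegree_X_sub_C, mul_one]

theorem card_support_X_sub_one_pow_pred_le (p : ℕ) [Fact p.Prime] [CharP F p] (t k n : ℕ) :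
    ((X - 1 : F[X]) ^ (p ^ (t + 1) * (p ^ k - 1) + p ^ t * n)).support.card ≤
      (n + 1) * p ^ k := by
  rw [pow_add, mul_comm (n + 1)]
  refine card_support_mul_le.trans (Nat.mul_le_mul ?_ (card_support_X_sub_one_pow_le p t n))
  refine (card_support_X_sub_one_pow_le p (t + 1) _).trans ?_
  rw [Nat.sub_add_cancel (pow_pos (Fact.out : p.Prime).pos k)]

end Weight

/-! ### The ambient ring and the powers of x - 1 -/

section Ambient

theorem exists_sum_add_xSubOne_pow_mul {R : Type*} [CommRing R] {N : ℕ} (M : ℕ)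
    (w : CyclicAmbient R N) :
    ∃ (c : ℕ → R) (v : CyclicAmbient R N),
      w = ∑ j ∈ Finset.range M, AdjoinRoot.of (X ^ N - 1 : R[X]) (c j) * xSubOne R N ^ j +
        xSubOne R N ^ M * v := by
  induction M with
  | zero => exact ⟨0, w, by simp⟩
  | succ M ih =>
    obtain ⟨c, v, h⟩ := ih
    obtain ⟨f, rfl⟩ := AdjoinRoot.mk_surjective v
    obtain ⟨g, hg⟩ : X - 1 ∣ f - C (f.eval 1) := by rw [← C_1]; exact X_sub_C_dvd_sub_C_eval
    refine ⟨Function.update c M (f.eval 1), AdjoinRoot.mk _ g, ?_⟩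
    have hsum : ∑ j ∈ Finset.range M, AdjoinRoot.of (X ^ N - 1 : R[X])
        (Function.update c M (f.eval 1) j) * xSubOne R N ^ j =
        ∑ j ∈ Finset.range M, AdjoinRoot.of (X ^ N - 1 : R[X]) (c j) * xSubOne R N ^ j :=
      Finset.sum_congr rfl fun j hj => by
        rw [Function.update_of_ne (Finset.mem_range.1 hj).ne]
    have hf : AdjoinRoot.mk (X ^ N - 1 : R[X]) f =
        AdjoinRoot.of (X ^ N - 1 : R[X]) (f.eval 1) + xSubOne R N * AdjoinRoot.mk _ g := by
      rw [xSubOne, ← map_mul, ← hg, map_sub, AdjoinRoot.mk_C]; ring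
    rw [Finset.sum_range_succ, Function.update_self, hsum, h, hf]
    ring

variable {F : Type*} [Field F] {p : ℕ} [Fact p.Prime] [CharP F p] {s : ℕ}

theorem X_sub_one_ne_zero : (X - 1 : F[X]) ≠ 0 := by
  rw [← C_1]; exact X_sub_C_ne_zero 1

theorem xSubOne_pow_eq_zero_iff {i : ℕ} : xSubOne F (p ^ s) ^ i = 0 ↔ p ^ s ≤ i := by
  rw [xSubOne, ← map_pow, AdjoinRoot.mk_eq_zero, ← X_sub_one_pow_char_pow p s]
  constructor
  · intro h
    have := le_natDegree_of_X_sub_one_pow_dvd (pow_ne_zero _ X_sub_one_ne_zero) h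
    rwa [natDegree_pow, ← C_1, natDegree_X_sub_C, mul_one] at this
  · exact pow_dvd_pow _

theorem xSubOne_isNilpotent : IsNilpotent (xSubOne F (p ^ s)) :=
  ⟨p ^ s, xSubOne_pow_eq_zero_iff.2 le_rfl⟩

theorem exists_eq_xSubOne_pow_mul {k : ℕ} (hk : k ≤ p ^ s) {w : CyclicAmbient F (p ^ s)}
    (h : xSubOne F (p ^ s) ^ k * w = 0) : ∃ v, w = xSubOne F (p ^ s) ^ (p ^ s - k) * v := by
  obtain ⟨f, rfl⟩ := AdjoinRoot.mk_surjective w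
  rw [xSubOne, ← map_pow, ← map_mul, AdjoinRoot.mk_eq_zero, ← X_sub_one_pow_char_pow p s] at h
  obtain ⟨g, hg⟩ := h
  refine ⟨AdjoinRoot.mk _ g, ?_⟩
  rw [xSubOne, ← map_pow, ← map_mul]
  congr 1
  apply mul_left_cancel₀ (pow_ne_zero k (X_sub_one_ne_zero (F := F)))
  rw [hg, ← mul_assoc, ← pow_add, Nat.add_sub_cancel' hk]

/-- The preimage in F[X] is principal, and its generator divides (X - 1)^(p^s), hence is a power of
the prime X - 1 up to a unit. -/
theorem exists_eq_span_xSubOne_pow (I : Ideal (CyclicAmbient F (p ^ s))) :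
    ∃ T ≤ p ^ s, I = Ideal.span {xSubOne F (p ^ s) ^ T} := by
  obtain ⟨g, hg⟩ := (IsPrincipalIdealRing.principal
    (I.comap (AdjoinRoot.mk (X ^ p ^ s - 1 : F[X])))).principal
  have hI : I = Ideal.span {AdjoinRoot.mk (X ^ p ^ s - 1 : F[X]) g} := by
    rw [← Ideal.map_comap_of_surjective _ AdjoinRoot.mk_surjective I, hg]
    exact Ideal.map_span _ _ |>.trans (by rw [Set.image_singleton])
  have hdvd : g ∣ (X - 1) ^ p ^ s := by
    rw [X_sub_one_pow_char_pow, ← Ideal.mem_span_singleton]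
    change _ ∈ Submodule.span F[X] {g}
    rw [← hg, Ideal.mem_comap, AdjoinRoot.mk_self]
    exact I.zero_mem
  have hprime : Prime (X - 1 : F[X]) := by rw [← C_1]; exact prime_X_sub_C 1
  obtain ⟨T, hT, hass⟩ := (dvd_prime_pow hprime _).1 hdvd
  refine ⟨T, hT, ?_⟩
  rw [hI, xSubOne, ← map_pow]
  obtain ⟨v, hv⟩ := hass.map (AdjoinRoot.mk (X ^ p ^ s - 1 : F[X]))
  rw [← hv]
  exact (Ideal.span_singleton_mul_right_unit v.isUnit _).symm

theorem le_of_xSubOne_pow_mem {i j : ℕ} (hi : i < p ^ s)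
    (h : xSubOne F (p ^ s) ^ i ∈ Ideal.span {xSubOne F (p ^ s) ^ j}) : j ≤ i := by
  by_contra! hlt
  obtain ⟨c, hc⟩ := Ideal.mem_span_singleton.1 h
  -- If j > i, multiplying u^i by u^(p^s - 1 - i) pushes the exponent of the multiple of u^j up to
  -- at least p^s.
  have h1 : xSubOne F (p ^ s) ^ (p ^ s - 1) = 0 := by
    rw [show p ^ s - 1 = (p ^ s - 1 - i) + i by omega, pow_add, hc, ← mul_assoc, ← pow_add,
      xSubOne_pow_eq_zero_iff.2 (by omega), zero_mul]
  have := xSubOne_pow_eq_zero_iff.1 h1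
  omega

theorem span_xSubOne_pow_injective {i j : ℕ} (hi : i ≤ p ^ s) (hj : j ≤ p ^ s)
    (h : Ideal.span {xSubOne F (p ^ s) ^ i} = Ideal.span {xSubOne F (p ^ s) ^ j}) : i = j := by
  have key : ∀ {a b : ℕ}, a ≤ p ^ s → b ≤ p ^ s →
      Ideal.span {xSubOne F (p ^ s) ^ a} = Ideal.span {xSubOne F (p ^ s) ^ b} → a ≤ b := by
    intro a b ha hb hab
    rcases hb.eq_or_lt with rfl | hlt
    · exact ha
    · exact le_of_xSubOne_pow_mem hlt (hab.symm ▸ Ideal.mem_span_singleton_self _)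
  exact le_antisymm (key hi hj h) (key hj hi h.symm)

theorem span_pow_sup_span_pow {A : Type*} [CommRing A] (u : A) (a b : ℕ) :
    Ideal.span {u ^ a} ⊔ Ideal.span {u ^ b} = Ideal.span {u ^ min a b} := by
  have key : ∀ {i j : ℕ}, i ≤ j → Ideal.span {u ^ j} ≤ Ideal.span {u ^ i} := fun h =>
    Ideal.span_singleton_le_span_singleton.2 (pow_dvd_pow _ h)
  rcases le_total a b with h | h
  · rw [min_eq_left h, sup_eq_left.2 (key h)]
  · rw [min_eq_right h, sup_eq_right.2 (key h)]

theorem IsUnit.add_isNilpotent {A : Type*} [CommRing A] {a b : A} (ha : IsUnit a)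
    (hb : IsNilpotent b) : IsUnit (a + b) :=
  hb.isUnit_add_left_of_commute ha (Commute.all _ _)

/-- After u^z is factored out, the constant term is a unit and the rest is a multiple of the
nilpotent u. -/
theorem exists_isUnit_sum_eq {c : ℕ → F} {z M : ℕ} (hz : z < M) (h0 : ∀ j < z, c j = 0)
    (hc : c z ≠ 0) :
    ∃ v, IsUnit v ∧ ∑ j ∈ Finset.range M,
      AdjoinRoot.of (X ^ p ^ s - 1 : F[X]) (c j) * xSubOne F (p ^ s) ^ j =
        xSubOne F (p ^ s) ^ z * v := by
  obtain ⟨d, rfl⟩ := Nat.exists_eq_add_of_lt hz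
  set u := xSubOne F (p ^ s) with hu
  refine ⟨AdjoinRoot.of _ (c z) + u * ∑ j ∈ Finset.range d,
    AdjoinRoot.of (X ^ p ^ s - 1 : F[X]) (c (z + j + 1)) * u ^ j, ?_, ?_⟩
  · refine IsUnit.add_isNilpotent (hc.isUnit.map _) ?_
    exact (Commute.all _ _).isNilpotent_mul_right xSubOne_isNilpotent
  · rw [show z + d + 1 = z + (d + 1) by ring, Finset.sum_range_add, Finset.sum_eq_zero, zero_add,
      Finset.sum_range_succ', mul_add, Finset.mul_sum, Finset.mul_sum, add_comm]
    · congr 1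
      · simp only [add_zero]; ring
      · refine Finset.sum_congr rfl fun j _ => ?_
        rw [← add_assoc]; ring
    · intro j hj
      rw [h0 j (Finset.mem_range.1 hj), map_zero, zero_mul]

theorem span_pow_mul_isUnit_sub {A : Type*} [CommRing A] {u : A} (hu : IsNilpotent u) {a b : ℕ}
    (hab : a ≠ b) {v w : A} (hv : IsUnit v) (hw : IsUnit w) :
    Ideal.span {u ^ a * v - u ^ b * w} = Ideal.span {u ^ min a b} := by
  have key : ∀ {a b : ℕ} {v w : A}, IsUnit v → a < b →
      Ideal.span {u ^ a * v - u ^ b * w} = Ideal.span {u ^ a} := by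
    intro a b v w hv hlt
    obtain ⟨d, rfl⟩ := Nat.exists_eq_add_of_lt hlt
    rw [show u ^ a * v - u ^ (a + d + 1) * w = u ^ a * (v + u * (- u ^ d * w)) by ring]
    exact Ideal.span_singleton_mul_right_unit (hv.add_isNilpotent
      ((Commute.all _ _).isNilpotent_mul_right hu)) _
  rcases hab.lt_or_gt with h | h
  · rw [min_eq_left h.le, key hv h]
  · rw [min_eq_right h.le, ← Ideal.span_singleton_neg, neg_sub, key hw h]

end Ambient

/-! ### Hamming distances over the residue field -/

section ResidueFieldDistance

variable {F : Type*} [Field F] {p : ℕ} [Fact p.Prime] [CharP F p] {s : ℕ}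

theorem mk_mem_span_xSubOne_pow_iff {i : ℕ} (hi : i ≤ p ^ s) {f : F[X]} :
    AdjoinRoot.mk (X ^ p ^ s - 1 : F[X]) f ∈ Ideal.span {xSubOne F (p ^ s) ^ i} ↔
      (X - 1) ^ i ∣ f := by
  rw [Ideal.mem_span_singleton, xSubOne, ← map_pow]
  constructor
  · rintro ⟨c, hc⟩
    obtain ⟨g, rfl⟩ := AdjoinRoot.mk_surjective c
    rw [← map_mul, AdjoinRoot.mk_eq_mk, ← X_sub_one_pow_char_pow p s] at hc
    have := dvd_add ((pow_dvd_pow _ hi).trans hc) (dvd_mul_right ((X - 1) ^ i) g)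
    simpa using this
  · exact map_dvd _

/-- Here i is any exponent in a block and j the last one: the lower bound already holds at i, and (X
- 1)^j is a low-weight word of the code. -/
theorem hammingDistance_span_eq {i j D : ℕ} (hij : i ≤ j) (hj : j < p ^ s)
    (hup : ((X - 1 : F[X]) ^ j).support.card ≤ D)
    (hlow : ∀ f : F[X], f ≠ 0 → f.degree < (p ^ s : ℕ) → (X - 1) ^ i ∣ f → D ≤ f.support.card) :
    hammingDistance (Ideal.span {xSubOne F (p ^ s) ^ i}) = D := by
  have hmem : ((X - 1 : F[X]) ^ j).support.card ∈ {w | ∃ f : F[X], f ≠ 0 ∧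
      f.degree < (p ^ s : ℕ) ∧ AdjoinRoot.mk (X ^ p ^ s - 1 : F[X]) f ∈
        Ideal.span {xSubOne F (p ^ s) ^ i} ∧ f.support.card = w} := by
    refine ⟨(X - 1) ^ j, pow_ne_zero _ X_sub_one_ne_zero, ?_, ?_, rfl⟩
    · rw [degree_pow, degree_X_sub_one]
      rw [nsmul_one]
      exact_mod_cast hj
    · rw [mk_mem_span_xSubOne_pow_iff (hij.trans hj.le)]
      exact pow_dvd_pow _ hij
  apply le_antisymm
  · exact (Nat.sInf_le hmem).trans hup
  · refine le_csInf ⟨_, hmem⟩ ?_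
    rintro w ⟨f, hf, hd, hm, rfl⟩
    exact hlow f hf hd ((mk_mem_span_xSubOne_pow_iff (hij.trans hj.le)).1 hm)

theorem hammingDistance_span_zero :
    hammingDistance (Ideal.span {xSubOne F (p ^ s) ^ 0}) = 1 := by
  refine hammingDistance_span_eq le_rfl (pow_pos (Fact.out : p.Prime).pos s) ?_ ?_
  · simpa using card_support_X_sub_one_pow_le (F := F) p 0 0
  · intro f hf _ _
    exact Finset.card_pos.2 (support_nonempty.2 hf)

/-- The distance of `⟨(x - 1)^i⟩` for `i` in the `b`-th block of the bottom level. -/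
theorem hammingDistance_span_eq_add_two {t b i : ℕ} (hb : b + 1 < p) (h1 : b * p ^ t + 1 ≤ i)
    (h2 : i ≤ (b + 1) * p ^ t) :
    hammingDistance (Ideal.span {xSubOne F (p ^ (t + 1)) ^ i}) = b + 2 := by
  refine hammingDistance_span_eq (j := p ^ t * (b + 1)) (by linarith) ?_
    (card_support_X_sub_one_pow_le p t (b + 1))
    fun f hf hd hdv => add_two_le_card_support hf hd hdv h1
  rw [pow_succ]
  exact Nat.mul_lt_mul_of_pos_left hb (pow_pos (Fact.out : p.Prime).pos t)

/-- The distance of `⟨(x - 1)^i⟩` for `i` in the `b`-th block of the `k`-th level. -/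
theorem hammingDistance_span_eq_mul_pow {t k b i : ℕ} (hb : b + 1 < p)
    (h1 : p ^ (t + 1 + k) - p ^ (t + 1) + b * p ^ t + 1 ≤ i)
    (h2 : i ≤ p ^ (t + 1 + k) - p ^ (t + 1) + (b + 1) * p ^ t) :
    hammingDistance (Ideal.span {xSubOne F (p ^ (t + 1 + k)) ^ i}) = (b + 2) * p ^ k := by
  have hj : p ^ (t + 1) * (p ^ k - 1) + p ^ t * (b + 1) =
      p ^ (t + 1 + k) - p ^ (t + 1) + (b + 1) * p ^ t := by
    rw [Nat.mul_sub, ← pow_add, mul_one, mul_comm (p ^ t)]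
  have hlt : (b + 1) * p ^ t < p ^ (t + 1) := by
    rw [pow_succ, mul_comm]
    exact Nat.mul_lt_mul_of_pos_left hb (pow_pos (Fact.out : p.Prime).pos t)
  have hle : p ^ (t + 1) ≤ p ^ (t + 1 + k) :=
    Nat.pow_le_pow_right (Fact.out : p.Prime).pos (Nat.le_add_right _ _)
  exact hammingDistance_span_eq (h2.trans hj.ge) (by omega)
    (card_support_X_sub_one_pow_pred_le p t k (b + 1))
    fun f hf hd hdv => mul_le_card_support hf hd hdv h1

end ResidueFieldDistance

/-! ### Multiplication by p and reduction modulo p -/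

section Galois

open IsLocalRing

variable {p m s : ℕ} {R : Type*} [CommRing R] [IsLocalRing R]

theorem IsGaloisRing.residue_eq_zero_iff_dvd (h : IsGaloisRing p 2 m R) {r : R} :
    residue R r = 0 ↔ (p : R) ∣ r := by
  rw [residue_eq_zero_iff, h.maximalIdeal_eq, Ideal.mem_span_singleton]

theorem IsGaloisRing.natCast_ne_zero (h : IsGaloisRing p 2 m R) (hp : p.Prime) : (p : R) ≠ 0 := by
  have := h.charP
  intro h0
  have h1 := Nat.le_of_dvd hp.pos ((CharP.cast_eq_zero_iff R (p ^ 2) p).1 h0)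
  nlinarith [hp.two_le]

theorem IsGaloisRing.natCast_mul_eq_zero_iff (h : IsGaloisRing p 2 m R) (hp : p.Prime) {r : R} :
    (p : R) * r = 0 ↔ residue R r = 0 := by
  constructor
  · intro h0
    rw [residue_eq_zero_iff, mem_maximalIdeal]
    exact fun hu => h.natCast_ne_zero hp (hu.mul_left_eq_zero.1 h0)
  · rw [h.residue_eq_zero_iff_dvd]
    rintro ⟨a, rfl⟩
    rw [← mul_assoc, h.p_sq, zero_mul]

theorem IsGaloisRing.natCast_mul_eq_iff (h : IsGaloisRing p 2 m R) (hp : p.Prime) {r t : R} :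
    (p : R) * r = p * t ↔ residue R r = residue R t := by
  rw [← sub_eq_zero, ← mul_sub, h.natCast_mul_eq_zero_iff hp, map_sub, sub_eq_zero]

theorem IsGaloisRing.charP_residueField (h : IsGaloisRing p 2 m R) (hp : p.Prime) :
    CharP (ResidueField R) p := by
  have h0 : ((p : ℕ) : ResidueField R) = 0 := by
    rw [← map_natCast (residue R), h.residue_eq_zero_iff_dvd]
  have := CharP.exists (ResidueField R)
  obtain ⟨c, hc⟩ := this
  rcases (Nat.dvd_prime hp).1 ((CharP.cast_eq_zero_iff _ c p).1 h0) with rfl | rfl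
  · exact absurd rfl (CharP.char_ne_one (ResidueField R) 1)
  · exact hc

theorem reduction_mk {N : ℕ} (f : R[X]) :
    reduction R N (AdjoinRoot.mk _ f) = AdjoinRoot.mk _ (f.map (residue R)) := by
  rw [reduction, AdjoinRoot.map, AdjoinRoot.lift_mk, ← AdjoinRoot.aeval_eq, aeval_def, eval₂_map,
    AdjoinRoot.algebraMap_eq]

theorem reduction_of {N : ℕ} (r : R) :
    reduction R N (AdjoinRoot.of _ r) = AdjoinRoot.of _ (residue R r) := by
  rw [reduction, AdjoinRoot.map_of]

theorem reduction_xSubOne {N : ℕ} :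
    reduction R N (xSubOne R N) = xSubOne (ResidueField R) N := by
  rw [xSubOne, reduction_mk, xSubOne]; simp

theorem reduction_surjective {N : ℕ} : Function.Surjective (reduction R N) := by
  intro w
  obtain ⟨f, rfl⟩ := AdjoinRoot.mk_surjective w
  obtain ⟨g, rfl⟩ := Polynomial.map_surjective _ residue_surjective f
  exact ⟨_, reduction_mk g⟩

theorem IsGaloisRing.exists_eq_C_mul (h : IsGaloisRing p 2 m R) {f : R[X]}
    (hf : f.map (residue R) = 0) : ∃ g, f = C (p : R) * g := by
  rw [← dvd_def, C_dvd_iff_dvd_coeff]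
  intro i
  rw [← h.residue_eq_zero_iff_dvd, ← coeff_map, hf, coeff_zero]

theorem IsGaloisRing.C_mul_eq_zero_iff (h : IsGaloisRing p 2 m R) (hp : p.Prime) {f : R[X]} :
    C (p : R) * f = 0 ↔ f.map (residue R) = 0 := by
  simp only [Polynomial.ext_iff, coeff_C_mul, coeff_map, coeff_zero, h.natCast_mul_eq_zero_iff hp]

theorem IsGaloisRing.support_C_mul (h : IsGaloisRing p 2 m R) (hp : p.Prime) (f : R[X]) :
    (C (p : R) * f).support = (f.map (residue R)).support := by
  ext i
  simp only [mem_support_iff, coeff_C_mul, coeff_map, ne_eq, h.natCast_mul_eq_zero_iff hp]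

theorem mk_C_natCast_mul {p : ℕ} {R : Type*} [CommRing R] {N : ℕ} (f : R[X]) :
    AdjoinRoot.mk (X ^ N - 1 : R[X]) (C (p : R) * f) = (p : CyclicAmbient R N) * AdjoinRoot.mk _ f := by
  rw [map_mul]; simp

theorem IsGaloisRing.exists_eq_natCast_mul (h : IsGaloisRing p 2 m R) {N : ℕ}
    {v : CyclicAmbient R N} (hv : reduction R N v = 0) : ∃ w, v = p * w := by
  obtain ⟨f, rfl⟩ := AdjoinRoot.mk_surjective v
  rw [reduction_mk, AdjoinRoot.mk_eq_zero] at hv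
  obtain ⟨g, hg⟩ := hv
  obtain ⟨g, rfl⟩ := Polynomial.map_surjective _ residue_surjective g
  obtain ⟨e, he⟩ := h.exists_eq_C_mul (f := f - (X ^ N - 1) * g) (by simp [hg])
  refine ⟨AdjoinRoot.mk _ e, ?_⟩
  rw [← mk_C_natCast_mul, ← he, map_sub, map_mul, AdjoinRoot.mk_self, zero_mul, sub_zero]

theorem IsGaloisRing.natCast_mul_ambient_eq_zero_iff (h : IsGaloisRing p 2 m R) (hp : p.Prime)
    {N : ℕ} (hN : N ≠ 0) {v : CyclicAmbient R N} : p * v = 0 ↔ reduction R N v = 0 := by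
  constructor
  · intro h0
    have hmon : (X ^ N - 1 : R[X]).Monic := monic_X_pow_sub_C 1 hN
    obtain ⟨f, rfl⟩ := AdjoinRoot.mk_surjective v
    -- The representative must have degree below N, so that the vanishing of its p-multiple in the
    -- quotient forces it to vanish as a polynomial.
    have hmod : AdjoinRoot.mk (X ^ N - 1 : R[X]) f = AdjoinRoot.mk _ (f %ₘ (X ^ N - 1)) := by
      rw [AdjoinRoot.mk_eq_mk]
      exact ⟨f /ₘ (X ^ N - 1), by
        conv_lhs => lhs; rw [← modByMonic_add_div f (X ^ N - 1 : R[X])]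
        ring⟩
    rw [hmod] at h0 ⊢
    rw [reduction_mk, (h.C_mul_eq_zero_iff hp).1, map_zero]
    by_contra hne
    refine AdjoinRoot.mk_ne_zero_of_degree_lt hmon hne ?_ ?_
    · refine (degree_mul_le _ _).trans_lt ?_
      refine (add_le_add_left degree_C_le _).trans_lt ?_
      rw [zero_add]
      exact degree_modByMonic_lt _ hmon
    · rw [mk_C_natCast_mul, h0]
  · intro h0
    obtain ⟨w, rfl⟩ := h.exists_eq_natCast_mul h0
    have := congrArg (AdjoinRoot.of (X ^ N - 1 : R[X])) h.p_sq
    simp only [map_mul, map_natCast, map_zero] at this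
    rw [← mul_assoc, this, zero_mul]

theorem IsGaloisRing.natCast_mul_ambient_eq_iff (h : IsGaloisRing p 2 m R) (hp : p.Prime)
    {N : ℕ} (hN : N ≠ 0) {v w : CyclicAmbient R N} :
    (p : CyclicAmbient R N) * v = p * w ↔ reduction R N v = reduction R N w := by
  rw [← sub_eq_zero, ← mul_sub, h.natCast_mul_ambient_eq_zero_iff hp hN, map_sub, sub_eq_zero]

end Galois

/-! ### Binomial coefficients modulo p² and the relation for (x - 1)^(p^s) -/

section Gamma

theorem emultiplicity_choose_mul_prime_pow {p : ℕ} (hp : p.Prime) (t : ℕ) {a : ℕ} (ha0 : a ≠ 0)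
    (ha : a < p) :
    emultiplicity p ((p ^ (t + 1)).choose (a * p ^ t)) = 1 := by
  have hle : a * p ^ t ≤ p ^ (t + 1) := by
    rw [pow_succ, mul_comm]; exact Nat.mul_le_mul_left _ ha.le
  have h1 := hp.emultiplicity_choose_prime_pow_add_emultiplicity hle
    (mul_ne_zero ha0 (pow_ne_zero _ hp.ne_zero))
  have h2 : emultiplicity p (a * p ^ t) = t := by
    rw [emultiplicity_mul hp.prime, emultiplicity_eq_zero.2 (Nat.not_dvd_of_pos_of_lt (by omega) ha),
      zero_add, emultiplicity_pow_self hp.ne_zero hp.prime.not_isUnit]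
  rw [h2] at h1
  push_cast at h1
  rw [add_comm] at h1
  exact (ENat.add_right_injective_of_ne_top (ENat.natCast_ne_top t)) h1

theorem sq_dvd_choose_prime_pow {p : ℕ} (hp : p.Prime) {t j : ℕ} (hj : j ≤ p ^ (t + 1))
    (hd : ¬ p ^ t ∣ j) :
    p ^ 2 ∣ (p ^ (t + 1)).choose j := by
  have hj0 : j ≠ 0 := by rintro rfl; simp at hd
  have h1 := hp.emultiplicity_choose_prime_pow_add_emultiplicity hj hj0
  rw [pow_dvd_iff_le_emultiplicity] at hd ⊢
  by_contra! hlt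
  have hlt' : emultiplicity p ((p ^ (t + 1)).choose j) ≤ 1 := by
    simpa using hlt
  push Not at hd
  have : emultiplicity p ((p ^ (t + 1)).choose j) + emultiplicity p j < 1 + (t : ℕ∞) :=
    ENat.add_lt_add_of_le_of_lt (ne_top_of_le_ne_top (ENat.natCast_ne_top 1) hlt') hlt' hd
  rw [h1] at this
  push_cast at this
  rw [add_comm] at this
  exact lt_irrefl _ this

theorem gammaCoeff_eq_zero {R : Type*} [CommRing R] {p m t j : ℕ} (hp : p.Prime) (hj : p ^ (t + 1) ≤ p ^ t + j) :
    gammaCoeff p m (t + 1) R j = 0 := by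
  rw [gammaCoeff, Nat.add_sub_cancel]
  refine if_neg fun hc => ?_
  have h1 : p - 1 ≤ j / p ^ t := by
    rw [Nat.le_div_iff_mul_le (pow_pos hp.pos t), Nat.sub_mul, one_mul, ← pow_succ']
    omega
  have := hp.two_le
  omega

theorem xSubOne_add_one_pow {R : Type*} [CommRing R] (N : ℕ) : (xSubOne R N + 1) ^ N = 1 := by
  have h1 : xSubOne R N + 1 = AdjoinRoot.mk (X ^ N - 1 : R[X]) X := by
    rw [xSubOne, map_sub, map_one, sub_add_cancel]
  rw [h1, ← map_pow, ← map_one (AdjoinRoot.mk (X ^ N - 1 : R[X])), AdjoinRoot.mk_eq_mk]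

open IsLocalRing

variable {p m : ℕ} {R : Type*} [CommRing R] [IsLocalRing R]

theorem IsGaloisRing.choose_eq_zero (h : IsGaloisRing p 2 m R) (hp : p.Prime) {t j : ℕ}
    (hj : j ≤ p ^ (t + 1)) (hd : ¬ p ^ t ∣ j) : ((p ^ (t + 1)).choose j : R) = 0 := by
  have := h.charP
  exact (CharP.cast_eq_zero_iff R (p ^ 2) _).2 (sq_dvd_choose_prime_pow hp hj hd)

theorem IsGaloisRing.choose_eq_mul_gammaCoeff (h : IsGaloisRing p 2 m R) (hp : p.Prime) {t j : ℕ}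
    (hj : p ^ t + j < p ^ (t + 1)) :
    ((p ^ (t + 1)).choose (p ^ t + j) : R) = p * gammaCoeff p m (t + 1) R j := by
  rw [gammaCoeff, Nat.add_sub_cancel]
  have hq : 0 < p ^ t := pow_pos hp.pos t
  by_cases hd : p ^ t ∣ j
  · obtain ⟨a, rfl⟩ := hd
    rw [Nat.mul_div_cancel_left _ hq]
    have ha : a + 1 < p := by
      rw [pow_succ] at hj
      exact Nat.lt_of_mul_lt_mul_left (a := p ^ t) (by linarith)
    rw [if_pos ⟨dvd_mul_right _ _, by omega⟩]
    have h1 : p ^ t + p ^ t * a = (a + 1) * p ^ t := by ring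
    rw [h1]
    rw [(h.natCast_mul_eq_iff hp).2 (residue_teichmullerRep h hp _), ← Nat.cast_mul,
      Nat.mul_div_cancel']
    apply dvd_of_emultiplicity_pos
    rw [emultiplicity_choose_mul_prime_pow hp t (Nat.succ_ne_zero a) ha]
    exact one_pos
  · rw [if_neg (fun hc => hd hc.1), mul_zero]
    exact h.choose_eq_zero hp hj.le (by rwa [Nat.dvd_add_right dvd_rfl])

theorem IsGaloisRing.residue_gammaCoeff_zero_ne (h : IsGaloisRing p 2 m R) (hp : p.Prime) (t : ℕ) :
    residue R (gammaCoeff p m (t + 1) R 0) ≠ 0 := by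
  have := h.charP_residueField hp
  rw [gammaCoeff, if_pos ⟨dvd_zero _, by simpa using hp.two_le⟩, residue_teichmullerRep h hp,
    map_natCast, Nat.zero_div, Nat.add_sub_cancel, zero_add, ne_eq, CharP.cast_eq_zero_iff _ p]
  have hm := emultiplicity_choose_mul_prime_pow hp t one_ne_zero hp.one_lt
  intro hd
  have h1 : p ∣ (p ^ (t + 1)).choose (1 * p ^ t) := dvd_of_emultiplicity_pos (by rw [hm]; exact one_pos)
  have h2 : p ^ 2 ∣ (p ^ (t + 1)).choose (1 * p ^ t) := by
    rw [← Nat.mul_div_cancel' h1, pow_two]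
    exact Nat.mul_dvd_mul_left _ hd
  rw [pow_dvd_iff_le_emultiplicity, hm] at h2
  exact absurd h2 (by norm_num)

/-- Expand (u + 1)^N = 1. Modulo p² the binomials at exponents not divisible by p^t vanish, and the
others between 0 and N are p γ_j. -/
theorem IsGaloisRing.xSubOne_pow_self (h : IsGaloisRing p 2 m R) (hp : p.Prime) (t : ℕ) :
    xSubOne R (p ^ (t + 1)) ^ p ^ (t + 1) =
      -(p * (xSubOne R (p ^ (t + 1)) ^ p ^ t * ∑ j ∈ Finset.range (p ^ (t + 1)),
        AdjoinRoot.of _ (gammaCoeff p m (t + 1) R j) * xSubOne R (p ^ (t + 1)) ^ j)) := by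
  have hq : 0 < p ^ t := pow_pos hp.pos t
  have hle : p ^ t ≤ p ^ (t + 1) := Nat.pow_le_pow_right hp.pos t.le_succ
  obtain ⟨d, hd⟩ := Nat.exists_eq_add_of_le hle
  have hadd := xSubOne_add_one_pow (R := R) (p ^ (t + 1))
  set u := xSubOne R (p ^ (t + 1)) with hu
  rw [add_pow, Finset.sum_range_succ, Nat.choose_self] at hadd
  have h1 : ∑ j ∈ Finset.range (p ^ (t + 1)),
      u ^ j * 1 ^ (p ^ (t + 1) - j) * ((p ^ (t + 1)).choose j : CyclicAmbient R (p ^ (t + 1))) =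
      1 + p * (u ^ p ^ t * ∑ j ∈ Finset.range (p ^ (t + 1)),
        AdjoinRoot.of _ (gammaCoeff p m (t + 1) R j) * u ^ j) := by
    -- The two sums are cut differently: on the left the first p^t terms reduce to j = 0, on the
    -- right the last p^t coefficients γ_j vanish.
    have hr : Finset.range (p ^ (t + 1)) = Finset.range (p ^ t + d) := by rw [hd]
    have hr' : Finset.range (p ^ (t + 1)) = Finset.range (d + p ^ t) := by rw [hd, add_comm]
    conv_lhs => rw [hr, Finset.sum_range_add]
    conv_rhs => rw [hr', Finset.sum_range_add]
    congr 1
    · rw [Finset.sum_eq_single 0]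
      · simp
      · intro j hj hj0
        have hjq := Finset.mem_range.1 hj
        have := congrArg (AdjoinRoot.of (X ^ p ^ (t + 1) - 1 : R[X]))
          (h.choose_eq_zero hp (t := t) (j := j) (by omega)
            (Nat.not_dvd_of_pos_of_lt (Nat.pos_of_ne_zero hj0) hjq))
        rw [map_natCast, map_zero] at this
        rw [this, mul_zero]
      · intro hn
        exact absurd (Finset.mem_range.2 hq) hn
    · rw [Finset.sum_eq_zero (s := Finset.range (p ^ t)), add_zero, Finset.mul_sum, Finset.mul_sum]
      · refine Finset.sum_congr rfl fun j hj => ?_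
        have := congrArg (AdjoinRoot.of (X ^ p ^ (t + 1) - 1 : R[X]))
          (h.choose_eq_mul_gammaCoeff hp (t := t) (j := j)
            (by have := Finset.mem_range.1 hj; omega))
        rw [map_natCast, map_mul, map_natCast] at this
        rw [this, one_pow, pow_add u]
        ring
      · intro j _
        rw [gammaCoeff_eq_zero hp (by omega), map_zero, zero_mul]
  rw [h1] at hadd
  simp only [Nat.sub_self, pow_zero, mul_one, Nat.cast_one] at hadd
  linear_combination hadd

end Gamma

/-! ### Torsion codes of ideals with two generators -/

section Torsion

open IsLocalRing

variable {p m : ℕ} {R : Type*} [CommRing R] [IsLocalRing R]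

theorem exists_torsionCode_eq_ideal {N : ℕ} (i : ℕ) (C : Ideal (CyclicAmbient R N)) :
    ∃ I : Ideal (CyclicAmbient (ResidueField R) N), torsionCode p i C = I := by
  let J : Ideal (CyclicAmbient R N) :=
    Submodule.comap (LinearMap.mulLeft _ ((p : CyclicAmbient R N) ^ i)) C
  refine ⟨J.map (reduction R N), ?_⟩
  ext w
  rw [SetLike.mem_coe, Ideal.mem_map_iff_of_surjective _ reduction_surjective]
  rfl

theorem IsGaloisRing.torsionalDegree_eq (h : IsGaloisRing p 2 m R) (hp : p.Prime) {s i T : ℕ}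
    {C : Ideal (CyclicAmbient R (p ^ s))} (hT : T ≤ p ^ s)
    (hC : torsionCode p i C = (Ideal.span {xSubOne (ResidueField R) (p ^ s) ^ T} : Set _)) :
    torsionalDegree p i C = T := by
  have := h.charP_residueField hp
  have := Fact.mk hp
  have hset : {T | T ≤ p ^ s ∧ torsionCode p i C =
      (Ideal.span {xSubOne (ResidueField R) (p ^ s) ^ T} : Set _)} = {T} := by
    ext T'
    refine ⟨fun hT' => ?_, fun hT' => ?_⟩
    · exact span_xSubOne_pow_injective (p := p) hT'.1 hT
        (SetLike.coe_injective (hT'.2.symm.trans hC))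
    · rw [Set.mem_singleton_iff.1 hT']
      exact ⟨hT, hC⟩
  rw [torsionalDegree, hset, csInf_singleton]

theorem IsGaloisRing.torsionalDegree_spec (h : IsGaloisRing p 2 m R) (hp : p.Prime) {s : ℕ} (i : ℕ)
    (C : Ideal (CyclicAmbient R (p ^ s))) :
    torsionalDegree p i C ≤ p ^ s ∧ torsionCode p i C =
      (Ideal.span {xSubOne (ResidueField R) (p ^ s) ^ torsionalDegree p i C} : Set _) := by
  have := h.charP_residueField hp
  have := Fact.mk hp
  obtain ⟨I, hI⟩ := exists_torsionCode_eq_ideal (p := p) i C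
  obtain ⟨T, hT, rfl⟩ := exists_eq_span_xSubOne_pow (p := p) I
  rw [h.torsionalDegree_eq hp hT hI]
  exact ⟨hT, hI⟩

/-- The reduction modulo `p` of `∑ γ_j (x - 1)^j`. -/
noncomputable def residueGammaSum (p m s : ℕ) (R : Type*) [CommRing R] [IsLocalRing R] :
    CyclicAmbient (ResidueField R) (p ^ s) :=
  ∑ j ∈ Finset.range (p ^ s), AdjoinRoot.of _ (residue R (gammaCoeff p m s R j)) *
    xSubOne (ResidueField R) (p ^ s) ^ j

theorem IsGaloisRing.isUnit_residueGammaSum (h : IsGaloisRing p 2 m R) (hp : p.Prime) (t : ℕ) :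
    IsUnit (residueGammaSum p m (t + 1) R) := by
  have := h.charP_residueField hp
  have := Fact.mk hp
  obtain ⟨v, hv, he⟩ := exists_isUnit_sum_eq (F := ResidueField R) (p := p) (s := t + 1)
    (c := fun j => residue R (gammaCoeff p m (t + 1) R j)) (z := 0) (M := p ^ (t + 1))
    (pow_pos hp.pos _) (by simp) (h.residue_gammaCoeff_zero_ne hp t)
  rw [pow_zero, one_mul] at he
  rw [residueGammaSum, he]
  exact hv

theorem IsGaloisRing.exists_xSubOne_pow_self (h : IsGaloisRing p 2 m R) (hp : p.Prime) (t : ℕ) :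
    ∃ G : CyclicAmbient R (p ^ (t + 1)), reduction R _ G = residueGammaSum p m (t + 1) R ∧
      xSubOne R (p ^ (t + 1)) ^ p ^ (t + 1) + p * (xSubOne R (p ^ (t + 1)) ^ p ^ t * G) = 0 := by
  refine ⟨_, ?_, by rw [h.xSubOne_pow_self hp t, neg_add_cancel]⟩
  rw [map_sum, residueGammaSum]
  refine Finset.sum_congr rfl fun j _ => ?_
  rw [map_mul, map_pow, reduction_of, reduction_xSubOne]

theorem IsGaloisRing.reduction_natCast_mul (h : IsGaloisRing p 2 m R) {N : ℕ}
    (v : CyclicAmbient R N) : reduction R N (p * v) = 0 := by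
  have h0 : residue R (p : R) = 0 := h.residue_eq_zero_iff_dvd.2 dvd_rfl
  have := congrArg (AdjoinRoot.of (X ^ N - 1 : (ResidueField R)[X])) h0
  rw [map_natCast, map_natCast, map_zero] at this
  rw [map_mul, map_natCast, this, zero_mul]

theorem IsGaloisRing.torsionCode_zero_span_pair (h : IsGaloisRing p 2 m R) {N : ℕ}
    (k : ℕ) (a g : CyclicAmbient R N) :
    torsionCode p 0 (Ideal.span {xSubOne R N ^ k + p * a, p * g}) =
      (Ideal.span {xSubOne (ResidueField R) N ^ k} : Set _) := by
  ext w
  simp only [torsionCode, Set.mem_ofPred_eq, pow_zero, one_mul, SetLike.mem_coe,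
    Ideal.mem_span_singleton', Ideal.mem_span_pair]
  constructor
  · rintro ⟨v, ⟨b, c, rfl⟩, rfl⟩
    refine ⟨reduction R N b, ?_⟩
    rw [map_add, map_mul, map_add, mul_left_comm, h.reduction_natCast_mul,
      h.reduction_natCast_mul, map_pow, reduction_xSubOne, add_zero, add_zero]
  · rintro ⟨b, rfl⟩
    obtain ⟨b, rfl⟩ := reduction_surjective b
    refine ⟨_, ⟨b, 0, rfl⟩, ?_⟩
    rw [map_add, map_mul, map_add, h.reduction_natCast_mul, map_pow, reduction_xSubOne, zero_mul,
      map_zero, add_zero, add_zero]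

theorem IsGaloisRing.torsionCode_one_span_pair (h : IsGaloisRing p 2 m R) (hp : p.Prime)
    {t k : ℕ} (hk : k ≤ p ^ (t + 1)) (a g : CyclicAmbient R (p ^ (t + 1))) :
    torsionCode p 1 (Ideal.span {xSubOne R (p ^ (t + 1)) ^ k + p * a, p * g}) =
      (Ideal.span {xSubOne (ResidueField R) (p ^ (t + 1)) ^ k,
        xSubOne (ResidueField R) (p ^ (t + 1)) ^ (p ^ (t + 1) - k) * reduction R _ a -
          xSubOne (ResidueField R) (p ^ (t + 1)) ^ p ^ t * residueGammaSum p m (t + 1) R,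
        reduction R _ g} : Set _) := by
  have := h.charP_residueField hp
  have := Fact.mk hp
  have hN : p ^ (t + 1) ≠ 0 := pow_ne_zero _ hp.ne_zero
  obtain ⟨G, hG, hrel⟩ := h.exists_xSubOne_pow_self hp t
  have hpp : (p : CyclicAmbient R (p ^ (t + 1))) * p = 0 := by
    rw [h.natCast_mul_ambient_eq_zero_iff hp hN, ← mul_one (p : CyclicAmbient R (p ^ (t + 1))),
      h.reduction_natCast_mul]
  rw [← hG]
  set u := xSubOne R (p ^ (t + 1)) with hu
  have hsplit : u ^ (p ^ (t + 1) - k) * u ^ k = u ^ p ^ (t + 1) := by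
    rw [← pow_add, Nat.sub_add_cancel hk]
  ext w
  simp only [torsionCode, Set.mem_ofPred_eq, pow_one, SetLike.mem_coe, Ideal.mem_span_insert,
    Ideal.mem_span_singleton', ← reduction_xSubOne (R := R), ← hu]
  constructor
  · rintro ⟨v, ⟨b, -, ⟨c, rfl⟩, hv⟩, rfl⟩
    -- Reducing p v = b(u^k + p a) + c p g modulo p leaves u^k b = 0, so b = u^(N-k) b' + p e.
    have hb : xSubOne (ResidueField R) (p ^ (t + 1)) ^ k * reduction R _ b = 0 := by
      have := congrArg (reduction R (p ^ (t + 1))) hv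
      rw [h.reduction_natCast_mul, mul_left_comm c, map_add, h.reduction_natCast_mul, map_mul,
        map_add, h.reduction_natCast_mul, map_pow, reduction_xSubOne, add_zero, add_zero] at this
      rw [mul_comm, ← this]
    obtain ⟨b', hb'⟩ := exists_eq_xSubOne_pow_mul hk hb
    obtain ⟨b', rfl⟩ := reduction_surjective b'
    rw [← reduction_xSubOne (R := R), ← map_pow, ← map_mul, ← sub_eq_zero, ← map_sub] at hb'
    obtain ⟨e, he⟩ := h.exists_eq_natCast_mul hb'
    refine ⟨reduction R _ e, _, ⟨reduction R _ b', _, ⟨reduction R _ c, rfl⟩, rfl⟩, ?_⟩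
    simp only [← map_mul, ← map_pow, ← map_sub, ← map_add]
    rw [← h.natCast_mul_ambient_eq_iff hp hN, hv]
    rw [sub_eq_iff_eq_add.1 he]
    linear_combination b' * hsplit + b' * hrel + e * a * hpp
  · rintro ⟨e, -, ⟨b, -, ⟨c, rfl⟩, rfl⟩, rfl⟩
    obtain ⟨e, rfl⟩ := reduction_surjective e
    obtain ⟨b, rfl⟩ := reduction_surjective b
    obtain ⟨c, rfl⟩ := reduction_surjective c
    refine ⟨e * u ^ k + (b * (u ^ (p ^ (t + 1) - k) * a - u ^ p ^ t * G) + c * g),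
      ⟨b * u ^ (p ^ (t + 1) - k) + p * e, _, ⟨c, rfl⟩, ?_⟩, ?_⟩
    · linear_combination -b * hsplit - b * hrel - e * a * hpp
    · simp only [map_add, map_mul, map_sub, map_pow]

theorem IsGaloisRing.torsionalDegree_span_pair (h : IsGaloisRing p 2 m R) (hp : p.Prime)
    {t k e n : ℕ} (hk : k ≤ p ^ (t + 1)) {a g : CyclicAmbient R (p ^ (t + 1))}
    (ha : Ideal.span {xSubOne (ResidueField R) (p ^ (t + 1)) ^ (p ^ (t + 1) - k) *
        reduction R _ a -
          xSubOne (ResidueField R) (p ^ (t + 1)) ^ p ^ t * residueGammaSum p m (t + 1) R} =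
      Ideal.span {xSubOne (ResidueField R) (p ^ (t + 1)) ^ e})
    (hg : Ideal.span {reduction R _ g} = Ideal.span {xSubOne (ResidueField R) (p ^ (t + 1)) ^ n})
    {C : Ideal (CyclicAmbient R (p ^ (t + 1)))}
    (hC : C = Ideal.span {xSubOne R (p ^ (t + 1)) ^ k + p * a, p * g}) :
    torsionalDegree p 0 C = k ∧ torsionalDegree p 1 C = min k (min e n) := by
  subst hC
  refine ⟨h.torsionalDegree_eq hp hk (h.torsionCode_zero_span_pair k a g),
    h.torsionalDegree_eq hp ((min_le_left _ _).trans hk) ?_⟩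
  rw [h.torsionCode_one_span_pair hp hk, Ideal.span_insert, Ideal.span_insert, ha, hg,
    span_pow_sup_span_pow, span_pow_sup_span_pow]

theorem IsGaloisRing.m_ne_zero (h : IsGaloisRing p 2 m R) (hp : p.Prime) : m ≠ 0 := by
  have hc := h.card_residueField hp
  have hfin : Finite (ResidueField R) :=
    Nat.finite_of_card_ne_zero (by rw [hc]; exact (pow_pos hp.pos m).ne')
  rintro rfl
  have h1 := Finite.one_lt_card (α := ResidueField R)
  rw [hc, pow_zero] at h1
  exact absurd h1 (lt_irrefl 1)

theorem pow_eq_self_of_mem_teichmullerSet {p m : ℕ} {R : Type*} [CommRing R] (hp : p.Prime) {x : R}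
    (hx : x ∈ teichmullerSet p m R) : x ^ p ^ m = x := by
  have hpos : 0 < p ^ m := pow_pos hp.pos m
  rcases hx with rfl | hx
  · exact zero_pow hpos.ne'
  · rw [← Nat.sub_add_cancel hpos, pow_succ, hx, one_mul]

/-- Congruence modulo p becomes congruence modulo p^(m+1) after raising to the power p^m. That power
fixes Teichmüller elements, and p^(m+1) = 0 since m ≥ 1. -/
theorem IsGaloisRing.eq_of_residue_eq (h : IsGaloisRing p 2 m R) (hp : p.Prime) {x y : R}
    (hx : x ∈ teichmullerSet p m R) (hy : y ∈ teichmullerSet p m R)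
    (hxy : residue R x = residue R y) : x = y := by
  rw [← sub_eq_zero, ← map_sub, h.residue_eq_zero_iff_dvd] at hxy
  have h1 := dvd_sub_pow_of_dvd_sub hxy m
  rw [pow_eq_self_of_mem_teichmullerSet hp hx, pow_eq_self_of_mem_teichmullerSet hp hy,
    pow_eq_zero_of_le (m := 2) (by have := h.m_ne_zero hp; omega) (by rw [pow_two, h.p_sq]),
    zero_dvd_iff, sub_eq_zero] at h1
  exact h1

theorem IsGaloisRing.gammaCoeff_mem (h : IsGaloisRing p 2 m R) (hp : p.Prime) (s j : ℕ) :
    gammaCoeff p m s R j ∈ teichmullerSet p m R := by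
  rw [gammaCoeff]
  split_ifs
  · exact teichmullerRep_mem h hp _
  · exact Or.inl rfl

theorem reduction_deltaPoly {N k l : ℕ} {η : ℕ → R} (hk : k - l ≤ N) (hη : ∀ j, k - l ≤ j → η j = 0) :
    reduction R N (deltaPoly N k l η) = ∑ j ∈ Finset.range N,
      AdjoinRoot.of _ (residue R (η j)) * xSubOne (ResidueField R) N ^ j := by
  rw [deltaPoly, map_sum]
  rw [← Finset.sum_subset (Finset.range_subset_range.2 hk)]
  · refine Finset.sum_congr rfl fun j _ => ?_
    rw [map_mul, map_pow, reduction_of, reduction_xSubOne]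
  · intro j _ hj
    rw [hη j (by simpa using hj), map_zero, map_zero, zero_mul]

theorem IsGaloisRing.isUnit_reduction_deltaPoly (h : IsGaloisRing p 2 m R) (hp : p.Prime)
    {s k l : ℕ} {η : ℕ → R} (hk : k < p ^ s) (hη : IsDeltaCoeff p m k l η) :
    IsUnit (reduction R _ (deltaPoly (p ^ s) k l η)) := by
  have := h.charP_residueField hp
  have := Fact.mk hp
  obtain ⟨v, hv, he⟩ := exists_isUnit_sum_eq (F := ResidueField R) (p := p) (s := s)
    (c := fun j => residue R (η j)) (z := 0) (M := p ^ s)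
    (pow_pos hp.pos _) (by simp)
    (fun h0 => hη.zero_ne (h.eq_of_residue_eq hp (hη.mem 0) (Or.inl rfl) (by rw [h0, map_zero])))
  rw [pow_zero, one_mul] at he
  rw [reduction_deltaPoly (by omega) hη.eq_zero, he]
  exact hv

theorem IsGaloisRing.span_deltaPoly_sub_gammaSum (h : IsGaloisRing p 2 m R) (hp : p.Prime)
    {s k l : ℕ} {η : ℕ → R} (hk : k < p ^ s) (hη : IsDeltaCoeff p m k l η) :
    ∃ v, IsUnit v ∧ reduction R _ (deltaPoly (p ^ s) k l η) - residueGammaSum p m s R =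
      xSubOne (ResidueField R) (p ^ s) ^ firstDiff p m s η * v := by
  have := h.charP_residueField hp
  have := Fact.mk hp
  have hmem : firstDiff p m s η ∈ {j | gammaCoeff p m s R j ≠ η j} ∪ {p ^ s} :=
    Nat.sInf_mem ⟨p ^ s, Or.inr rfl⟩
  have hle : firstDiff p m s η ≤ p ^ s := Nat.sInf_le (Or.inr rfl)
  have hlt : ∀ j < firstDiff p m s η, residue R (η j) - residue R (gammaCoeff p m s R j) = 0 := by
    intro j hj
    have := Nat.notMem_of_lt_sInf hj
    by_contra hne
    refine this (Or.inl fun he => hne ?_)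
    rw [he, sub_self]
  have hsub : reduction R _ (deltaPoly (p ^ s) k l η) - residueGammaSum p m s R =
      ∑ j ∈ Finset.range (p ^ s),
        AdjoinRoot.of _ (residue R (η j) - residue R (gammaCoeff p m s R j)) *
          xSubOne (ResidueField R) (p ^ s) ^ j := by
    rw [reduction_deltaPoly (by omega) hη.eq_zero, residueGammaSum, ← Finset.sum_sub_distrib]
    refine Finset.sum_congr rfl fun j _ => ?_
    rw [map_sub, sub_mul]
  rw [hsub]
  rcases hle.eq_or_lt with he | hl
  -- All coefficients below p^s agree, so both sides are zero; this is what the default value p^s of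
  -- z encodes.
  · refine ⟨1, isUnit_one, ?_⟩
    rw [he, xSubOne_pow_eq_zero_iff.2 le_rfl, zero_mul]
    refine Finset.sum_eq_zero fun j hj => ?_
    rw [hlt j (by rw [he]; simpa using hj), map_zero, zero_mul]
  · refine exists_isUnit_sum_eq hl hlt fun h0 => ?_
    rcases hmem with hm | hm
    · exact hm (h.eq_of_residue_eq hp (h.gammaCoeff_mem hp _ _) (hη.mem _) (sub_eq_zero.1 h0).symm)
    · exact absurd hm hl.ne

end Torsion

/-! ### Classification of the ideals -/

section Forms

open IsLocalRing

variable {p m : ℕ} {R : Type*} [CommRing R] [IsLocalRing R]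

/-- The exponents k and n are the torsional degrees T_0 and T_1. For k < p^s, lift u^k to u^k + p a
in C. Since p u^n lies in C, a matters only modulo u^n, and p a only through the residues of its
coefficients, so a may be a Teichmüller polynomial of degree below n. -/
theorem IsGaloisRing.exists_generators (h : IsGaloisRing p 2 m R) (hp : p.Prime) {s : ℕ}
    (C : Ideal (CyclicAmbient R (p ^ s))) :
    (∃ n ≤ p ^ s, C = Ideal.span {(p : CyclicAmbient R (p ^ s)) * xSubOne R (p ^ s) ^ n}) ∨
    ∃ (k n : ℕ) (c : ℕ → R), k < p ^ s ∧ n ≤ k ∧ (∀ j, c j ∈ teichmullerSet p m R) ∧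
      C = Ideal.span {xSubOne R (p ^ s) ^ k + p * ∑ j ∈ Finset.range n,
        AdjoinRoot.of _ (c j) * xSubOne R (p ^ s) ^ j, p * xSubOne R (p ^ s) ^ n} := by
  have := h.charP_residueField hp
  have := Fact.mk hp
  have hN : p ^ s ≠ 0 := pow_ne_zero _ hp.ne_zero
  obtain ⟨hk, H0⟩ := h.torsionalDegree_spec hp 0 C
  obtain ⟨hn, H1⟩ := h.torsionalDegree_spec hp 1 C
  set k := torsionalDegree p 0 C
  set n := torsionalDegree p 1 C
  set u := xSubOne R (p ^ s) with hu
  have hred : ∀ i, xSubOne (ResidueField R) (p ^ s) ^ i = reduction R _ (u ^ i) := by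
    intro i; rw [map_pow, reduction_xSubOne]
  have hpn : (p : CyclicAmbient R (p ^ s)) * u ^ n ∈ C := by
    have : xSubOne (ResidueField R) (p ^ s) ^ n ∈ torsionCode p 1 C := by
      rw [H1]; exact Ideal.mem_span_singleton_self _
    obtain ⟨v, hv, he⟩ := this
    rw [hred] at he
    rw [pow_one] at hv
    rwa [← (h.natCast_mul_ambient_eq_iff hp hN).2 he]
  have key : ∀ w, (p : CyclicAmbient R (p ^ s)) * w ∈ C →
      ∃ a, (p : CyclicAmbient R (p ^ s)) * w = a * (p * u ^ n) := by
    intro w hw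
    have hm : reduction R _ w ∈ torsionCode p 1 C := ⟨w, by rwa [pow_one], rfl⟩
    rw [H1, SetLike.mem_coe, Ideal.mem_span_singleton'] at hm
    obtain ⟨a, ha⟩ := hm
    obtain ⟨a, rfl⟩ := reduction_surjective a
    rw [hred, ← map_mul] at ha
    refine ⟨a, ?_⟩
    rw [← (h.natCast_mul_ambient_eq_iff hp hN).2 ha]
    ring
  rcases hk.eq_or_lt with hkN | hkN
  · left
    refine ⟨n, hn, le_antisymm (fun c hc => ?_) ?_⟩
    · have hm : reduction R _ c ∈ torsionCode p 0 C := ⟨c, by rwa [pow_zero, one_mul], rfl⟩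
      rw [H0, hkN, xSubOne_pow_eq_zero_iff.2 le_rfl, SetLike.mem_coe, Ideal.mem_span_singleton,
        zero_dvd_iff] at hm
      obtain ⟨w, rfl⟩ := h.exists_eq_natCast_mul hm
      obtain ⟨a, ha⟩ := key w hc
      exact Ideal.mem_span_singleton'.2 ⟨a, ha.symm⟩
    · rw [Ideal.span_singleton_le_iff_mem]; exact hpn
  · right
    obtain ⟨f, hf, hfk⟩ : xSubOne (ResidueField R) (p ^ s) ^ k ∈ torsionCode p 0 C := by
      rw [H0]; exact Ideal.mem_span_singleton_self _
    rw [pow_zero, one_mul] at hf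
    -- Multiplying the lift f by p puts u^k into Tor_1.
    have hnk : n ≤ k := by
      refine le_of_xSubOne_pow_mem (F := ResidueField R) (p := p) (s := s) hkN ?_
      rw [← SetLike.mem_coe, ← H1]
      exact ⟨f, by rw [pow_one]; exact C.mul_mem_left _ hf, hfk⟩
    rw [hred, ← sub_eq_zero, ← map_sub] at hfk
    obtain ⟨a, ha⟩ := h.exists_eq_natCast_mul hfk
    obtain ⟨c, v, hc⟩ := exists_sum_add_xSubOne_pow_mul n a
    have hsum : (p : CyclicAmbient R (p ^ s)) * ∑ j ∈ Finset.range n,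
        AdjoinRoot.of _ (teichmullerRep p m (c j)) * u ^ j =
        p * ∑ j ∈ Finset.range n, AdjoinRoot.of _ (c j) * u ^ j := by
      rw [h.natCast_mul_ambient_eq_iff hp hN, map_sum, map_sum]
      refine Finset.sum_congr rfl fun j _ => ?_
      rw [map_mul, map_mul, reduction_of, reduction_of, residue_teichmullerRep h hp]
    have hgen : u ^ k + p * ∑ j ∈ Finset.range n,
        AdjoinRoot.of _ (teichmullerRep p m (c j)) * u ^ j = f - v * (p * u ^ n) := by
      rw [hsum]
      linear_combination -ha - p * hc
    have hgenC : u ^ k + p * ∑ j ∈ Finset.range n,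
        AdjoinRoot.of _ (teichmullerRep p m (c j)) * u ^ j ∈ C := by
      rw [hgen]
      exact C.sub_mem hf (C.mul_mem_left _ hpn)
    refine ⟨k, n, fun j => teichmullerRep p m (c j), hkN, hnk,
      fun j => teichmullerRep_mem h hp _, le_antisymm (fun x hx => ?_) ?_⟩
    · have hm : reduction R _ x ∈ torsionCode p 0 C := ⟨x, by rwa [pow_zero, one_mul], rfl⟩
      rw [H0, SetLike.mem_coe, Ideal.mem_span_singleton'] at hm
      obtain ⟨b, hb⟩ := hm
      obtain ⟨b, rfl⟩ := reduction_surjective b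
      rw [hred, ← map_mul, eq_comm, ← sub_eq_zero, ← map_sub] at hb
      obtain ⟨w, hw⟩ := h.exists_eq_natCast_mul hb
      set e := ∑ j ∈ Finset.range n, AdjoinRoot.of (X ^ p ^ s - 1) (teichmullerRep p m (c j)) * u ^ j
      have hmem : (p : CyclicAmbient R (p ^ s)) * (w - b * e) ∈ C := by
        have : (p : CyclicAmbient R (p ^ s)) * (w - b * e) = x - b * (u ^ k + p * e) := by
          linear_combination -hw
        rw [this]
        exact C.sub_mem hx (C.mul_mem_left _ hgenC)
      obtain ⟨d, hd⟩ := key _ hmem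
      exact Ideal.mem_span_pair.2 ⟨b, d, by linear_combination -hd - hw⟩
    · rw [Ideal.span_le]
      rintro x (rfl | rfl)
      · exact hgenC
      · exact hpn

theorem sum_eq_zero_or_exists_deltaPoly {p m : ℕ} {R : Type*} [CommRing R] {N k n : ℕ} (hn : n ≤ k) {c : ℕ → R}
    (hc : ∀ j, c j ∈ teichmullerSet p m R) :
    (∑ j ∈ Finset.range n, AdjoinRoot.of (X ^ N - 1 : R[X]) (c j) * xSubOne R N ^ j = 0) ∨
    ∃ (l : ℕ) (η : ℕ → R), IsDeltaCoeff p m k l η ∧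
      ∑ j ∈ Finset.range n, AdjoinRoot.of (X ^ N - 1 : R[X]) (c j) * xSubOne R N ^ j =
        xSubOne R N ^ l * deltaPoly N k l η := by
  classical
  by_cases hex : ∃ j, j < n ∧ c j ≠ 0
  · right
    obtain ⟨hl, hcl⟩ := Nat.find_spec hex
    have hmin := fun j => Nat.find_min hex (m := j)
    set l := Nat.find hex
    obtain ⟨d, hd⟩ := Nat.exists_eq_add_of_le hl.le
    obtain ⟨e, he⟩ := Nat.exists_eq_add_of_le hn
    -- The exponent l is that of the first nonzero coefficient. The cutoff is needed because c is
    -- unconstrained beyond n.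
    refine ⟨l, fun j => if l + j < n then c (l + j) else 0, ⟨by omega, ?_, ?_, ?_⟩, ?_⟩
    · intro j
      split_ifs
      · exact hc _
      · exact Or.inl rfl
    · simpa [hl] using hcl
    · intro j hj
      exact if_neg (by omega)
    · rw [deltaPoly, show k - l = d + e by omega, hd, Finset.sum_range_add, Finset.sum_range_add,
        Finset.sum_eq_zero, zero_add, Finset.sum_eq_zero (s := Finset.range e), add_zero,
        Finset.mul_sum]
      · refine Finset.sum_congr rfl fun j hj => ?_
        rw [if_pos (by have := Finset.mem_range.1 hj; omega), pow_add]
        ring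
      · intro j _
        rw [if_neg (by omega), map_zero, zero_mul]
      · intro j hj
        have hjl := Finset.mem_range.1 hj
        have := hmin j hjl
        have h0 : c j = 0 := by
          by_contra hne
          exact this ⟨by omega, hne⟩
        rw [h0, map_zero, zero_mul]
  · left
    push Not at hex
    refine Finset.sum_eq_zero fun j hj => ?_
    rw [hex j (Finset.mem_range.1 hj), map_zero, zero_mul]

end Forms

/-! ### Reduction of the distance to the residue field -/

section Distance

open IsLocalRing

variable {p m : ℕ} {R : Type*} [CommRing R] [IsLocalRing R]

theorem Nat.sInf_eq_of_subset {S T : Set ℕ} (h1 : T ⊆ S) (h2 : ∀ w ∈ S, ∃ w' ∈ T, w' ≤ w) :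
    sInf S = sInf T := by
  rcases S.eq_empty_or_nonempty with rfl | ⟨w, hw⟩
  · rw [Set.subset_empty_iff.1 h1]
  · apply le_antisymm
    · obtain ⟨w', hw', -⟩ := h2 w hw
      exact Nat.sInf_le (h1 (Nat.sInf_mem ⟨w', hw'⟩))
    · obtain ⟨w', hw', hle⟩ := h2 _ (Nat.sInf_mem ⟨w, hw⟩)
      exact (Nat.sInf_le hw').trans hle

theorem degree_lt_of_support_subset {S T : Type*} [CommRing S] [CommRing T] {f : S[X]} {g : T[X]}
    {N : ℕ} (h : f.support ⊆ g.support) (hg : g.degree < (N : WithBot ℕ)) :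
    f.degree < (N : WithBot ℕ) := by
  rw [degree_lt_iff_coeff_zero] at hg ⊢
  intro i hi
  by_contra hne
  exact mem_support_iff.1 (h (mem_support_iff.2 hne)) (hg i hi)

theorem IsGaloisRing.hammingDistance_eq (h : IsGaloisRing p 2 m R) (hp : p.Prime) {N : ℕ}
    (hN : N ≠ 0) {C : Ideal (CyclicAmbient R N)} {I : Ideal (CyclicAmbient (ResidueField R) N)}
    (hI : torsionCode p 1 C = I) : hammingDistance C = hammingDistance I := by
  have hmemI : ∀ f : R[X], (p : CyclicAmbient R N) * AdjoinRoot.mk _ f ∈ C →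
      AdjoinRoot.mk _ (f.map (residue R)) ∈ I := by
    intro f hf
    rw [← SetLike.mem_coe, ← hI]
    exact ⟨_, by rwa [pow_one], reduction_mk f⟩
  refine Nat.sInf_eq_of_subset ?_ ?_
  · rintro w ⟨f, hf, hd, hm, rfl⟩
    obtain ⟨g, rfl⟩ := Polynomial.map_surjective _ residue_surjective f
    have hs := h.support_C_mul hp g
    refine ⟨Polynomial.C (p : R) * g, fun h0 => hf ((h.C_mul_eq_zero_iff hp).1 h0),
      degree_lt_of_support_subset hs.le hd, ?_, by rw [hs]⟩
    rw [← SetLike.mem_coe, ← hI] at hm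
    obtain ⟨v, hv, he⟩ := hm
    rw [← reduction_mk, ← h.natCast_mul_ambient_eq_iff hp hN] at he
    rw [mk_C_natCast_mul, ← he]
    rwa [pow_one] at hv
  · rintro w ⟨f, hf, hd, hm, rfl⟩
    -- A codeword p g has the weight of the reduction of g, a word of Tor_1. Any other codeword f
    -- reduces to a nonzero word of Tor_1, since p f is in C, and reduction does not raise the
    -- weight.
    by_cases h0 : f.map (residue R) = 0
    · obtain ⟨g, rfl⟩ := h.exists_eq_C_mul h0
      have hs := h.support_C_mul hp g
      refine ⟨_, ⟨g.map (residue R), fun h1 => hf ((h.C_mul_eq_zero_iff hp).2 h1),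
        degree_lt_of_support_subset hs.ge hd, hmemI g ?_, rfl⟩, by rw [hs]⟩
      rwa [← mk_C_natCast_mul]
    · exact ⟨_, ⟨_, h0, degree_lt_of_support_subset (support_map_subset _ f) hd,
        hmemI f (C.mul_mem_left _ hm), rfl⟩, Finset.card_le_card (support_map_subset _ f)⟩

end Distance

/-! ### Torsional degrees of the listed forms -/

section Torsion

open IsLocalRing

variable {p m : ℕ} {R : Type*} [CommRing R] [IsLocalRing R]

/-- The valuation of `x^(p^s - k) · x^l δ - x^(p^(s-1)) Γ` modulo `p`. -/
theorem IsGaloisRing.span_delta_relation (h : IsGaloisRing p 2 m R) (hp : p.Prime)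
    {t k l : ℕ} {η : ℕ → R} (hk : k < p ^ (t + 1)) (hη : IsDeltaCoeff p m k l η) :
    Ideal.span {xSubOne (ResidueField R) (p ^ (t + 1)) ^ (p ^ (t + 1) - k) *
        reduction R _ (xSubOne R (p ^ (t + 1)) ^ l * deltaPoly (p ^ (t + 1)) k l η) -
          xSubOne (ResidueField R) (p ^ (t + 1)) ^ p ^ t * residueGammaSum p m (t + 1) R} =
      Ideal.span {xSubOne (ResidueField R) (p ^ (t + 1)) ^
        if p ^ t = p ^ (t + 1) - k + l then p ^ t + firstDiff p m (t + 1) η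
        else min (p ^ t) (p ^ (t + 1) - k + l)} := by
  have := h.charP_residueField hp
  have := Fact.mk hp
  rw [map_mul, map_pow, reduction_xSubOne, ← mul_assoc, ← pow_add]
  split_ifs with he
  · obtain ⟨v, hv, hd⟩ := h.span_deltaPoly_sub_gammaSum hp hk hη
    rw [← he, ← mul_sub, hd, ← mul_assoc, ← pow_add]
    exact Ideal.span_singleton_mul_right_unit hv _
  · rw [min_comm]
    exact span_pow_mul_isUnit_sub (xSubOne_isNilpotent (p := p)) (Ne.symm he)
      (h.isUnit_reduction_deltaPoly hp hk hη) (h.isUnit_residueGammaSum hp t)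

theorem IsGaloisRing.span_zero_relation (h : IsGaloisRing p 2 m R) (hp : p.Prime) (t k : ℕ) :
    Ideal.span {xSubOne (ResidueField R) (p ^ (t + 1)) ^ (p ^ (t + 1) - k) *
        reduction R _ 0 -
          xSubOne (ResidueField R) (p ^ (t + 1)) ^ p ^ t * residueGammaSum p m (t + 1) R} =
      Ideal.span {xSubOne (ResidueField R) (p ^ (t + 1)) ^ p ^ t} := by
  rw [map_zero, mul_zero, zero_sub, Ideal.span_singleton_neg]
  exact Ideal.span_singleton_mul_right_unit (h.isUnit_residueGammaSum hp t) _

theorem span_reduction_xSubOne_pow {N : ℕ} (n : ℕ) :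
    Ideal.span {reduction R N (xSubOne R N ^ n)} =
      Ideal.span {xSubOne (ResidueField R) N ^ n} := by
  rw [map_pow, reduction_xSubOne]

/-- An absent second generator counts as exponent p^s, which is harmless in the minimum. -/
theorem IsGaloisRing.span_reduction_zero (h : IsGaloisRing p 2 m R) (hp : p.Prime) (s : ℕ) :
    Ideal.span {reduction R (p ^ s) 0} =
      Ideal.span {xSubOne (ResidueField R) (p ^ s) ^ p ^ s} := by
  have := h.charP_residueField hp
  have := Fact.mk hp
  rw [map_zero, xSubOne_pow_eq_zero_iff.2 le_rfl]

theorem IsGaloisRing.torsionalDegree_span_natCast_mul (h : IsGaloisRing p 2 m R) (hp : p.Prime)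
    {t n : ℕ} (hn : n ≤ p ^ (t + 1)) {C : Ideal (CyclicAmbient R (p ^ (t + 1)))}
    (hC : C = Ideal.span {(p : CyclicAmbient R (p ^ (t + 1))) * xSubOne R (p ^ (t + 1)) ^ n}) :
    torsionalDegree p 0 C = p ^ (t + 1) ∧ torsionalDegree p 1 C = n := by
  have := h.charP_residueField hp
  have := Fact.mk hp
  obtain ⟨G, hG, hrel⟩ := h.exists_xSubOne_pow_self hp t
  -- With k = N and a = u^(p^t) G the first generator u^N + p a is zero, so the two-generator
  -- formula applies; the bracket also vanishes, giving e = N.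
  have key := h.torsionalDegree_span_pair hp (e := p ^ (t + 1)) (n := n) (k := p ^ (t + 1)) le_rfl
    (a := xSubOne R (p ^ (t + 1)) ^ p ^ t * G) (g := xSubOne R (p ^ (t + 1)) ^ n) (C := C) ?_
    (span_reduction_xSubOne_pow n) ?_
  · simpa [hn] using key
  · rw [map_mul, map_pow, reduction_xSubOne, hG, Nat.sub_self, pow_zero, one_mul, sub_self,
      xSubOne_pow_eq_zero_iff.2 le_rfl]
  · rw [hrel, hC, Ideal.span_insert, Ideal.span_singleton_eq_bot.2 rfl, bot_sup_eq]

end Torsion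

theorem lemma4p8 (p m s : ℕ) (hp : p.Prime) (hs : 1 ≤ s)
    (R : Type*) [CommRing R] [IsLocalRing R] (hR : IsGaloisRing p 2 m R) :
    -- every cyclic code has one of the listed forms
    (∀ C : Ideal (CyclicAmbient R (p ^ s)),
      C = ⊥ ∨ C = ⊤ ∨
      (∃ n, n < p ^ s ∧
        C = Ideal.span {(p : CyclicAmbient R (p ^ s)) * xSubOne R (p ^ s) ^ n}) ∨
      (∃ k, k < p ^ s ∧ C = Ideal.span {xSubOne R (p ^ s) ^ k}) ∨
      (∃ (k l : ℕ) (η : ℕ → R), k < p ^ s ∧ IsDeltaCoeff p m k l η ∧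
        C = Ideal.span {xSubOne R (p ^ s) ^ k +
          p * xSubOne R (p ^ s) ^ l * deltaPoly (p ^ s) k l η}) ∨
      (∃ k n : ℕ, k < p ^ s ∧ n < k ∧
        C = Ideal.span {xSubOne R (p ^ s) ^ k, p * xSubOne R (p ^ s) ^ n}) ∨
      (∃ (k l n : ℕ) (η : ℕ → R), k < p ^ s ∧ n < k ∧ IsDeltaCoeff p m k l η ∧
        C = Ideal.span {xSubOne R (p ^ s) ^ k +
          p * xSubOne R (p ^ s) ^ l * deltaPoly (p ^ s) k l η,
          p * xSubOne R (p ^ s) ^ n})) ∧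
    -- the torsional degrees are well defined
    (∀ C : Ideal (CyclicAmbient R (p ^ s)), ∀ i < 2,
      torsionalDegree p i C ≤ p ^ s ∧
      torsionCode p i C = (Ideal.span {xSubOne (IsLocalRing.ResidueField R) (p ^ s) ^
        torsionalDegree p i C} : Set _)) ∧
    -- the torsional degrees of the forms
    (∀ k, k < p ^ s → ∀ C : Ideal (CyclicAmbient R (p ^ s)),
      C = Ideal.span {xSubOne R (p ^ s) ^ k} →
      torsionalDegree p 0 C = k ∧ torsionalDegree p 1 C = min k (p ^ (s - 1))) ∧
    (∀ (k l : ℕ) (η : ℕ → R), k < p ^ s → IsDeltaCoeff p m k l η →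
      ∀ C : Ideal (CyclicAmbient R (p ^ s)),
      C = Ideal.span {xSubOne R (p ^ s) ^ k +
        p * xSubOne R (p ^ s) ^ l * deltaPoly (p ^ s) k l η} →
      torsionalDegree p 0 C = k ∧
      (p ^ (s - 1) ≠ p ^ s - k + l →
        torsionalDegree p 1 C = min k (min (p ^ (s - 1)) (p ^ s - k + l))) ∧
      (p ^ (s - 1) = p ^ s - k + l →
        torsionalDegree p 1 C = min k (p ^ (s - 1) + firstDiff p m s η))) ∧
    (∀ k n : ℕ, k < p ^ s → n < k → ∀ C : Ideal (CyclicAmbient R (p ^ s)),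
      C = Ideal.span {xSubOne R (p ^ s) ^ k, p * xSubOne R (p ^ s) ^ n} →
      torsionalDegree p 0 C = k ∧
      torsionalDegree p 1 C = min k (min (p ^ (s - 1)) n)) ∧
    (∀ (k l n : ℕ) (η : ℕ → R), k < p ^ s → n < k → IsDeltaCoeff p m k l η →
      ∀ C : Ideal (CyclicAmbient R (p ^ s)),
      C = Ideal.span {xSubOne R (p ^ s) ^ k +
        p * xSubOne R (p ^ s) ^ l * deltaPoly (p ^ s) k l η,
        p * xSubOne R (p ^ s) ^ n} →
      torsionalDegree p 0 C = k ∧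
      (p ^ (s - 1) ≠ p ^ s - k + l →
        torsionalDegree p 1 C = min k (min (p ^ (s - 1)) (min (p ^ s - k + l) n))) ∧
      (p ^ (s - 1) = p ^ s - k + l →
        torsionalDegree p 1 C = min k (min (p ^ (s - 1) + firstDiff p m s η) n))) ∧
    (∀ n, n < p ^ s → ∀ C : Ideal (CyclicAmbient R (p ^ s)),
      C = Ideal.span {(p : CyclicAmbient R (p ^ s)) * xSubOne R (p ^ s) ^ n} →
      torsionalDegree p 0 C = p ^ s ∧ torsionalDegree p 1 C = n) ∧
    -- the Hamming distance is that of a cyclic code over the residue field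
    (∀ C : Ideal (CyclicAmbient R (p ^ s)), C ≠ ⊥ →
      hammingDistance C = hammingDistance
        (Ideal.span {xSubOne (IsLocalRing.ResidueField R) (p ^ s) ^ torsionalDegree p 1 C})) ∧
    -- the explicit Hamming distance of the codes over the residue field
    (∀ (i d : ℕ), d = hammingDistance
        (Ideal.span {xSubOne (IsLocalRing.ResidueField R) (p ^ s) ^ i}) →
      (i = 0 → d = 1) ∧
      (1 ≤ i → i ≤ p ^ (s - 1) → d = 2) ∧
      (∀ β, 1 ≤ β → β ≤ p - 2 →
        β * p ^ (s - 1) + 1 ≤ i → i ≤ (β + 1) * p ^ (s - 1) → d = β + 2) ∧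
      (∀ τ k, 1 ≤ τ → τ ≤ p - 1 → 1 ≤ k → k ≤ s - 1 →
        p ^ s - p ^ (s - k) + (τ - 1) * p ^ (s - k - 1) + 1 ≤ i →
        i ≤ p ^ s - p ^ (s - k) + τ * p ^ (s - k - 1) → d = (τ + 1) * p ^ k)) := by
  obtain ⟨t, rfl⟩ := Nat.exists_eq_add_of_le' hs
  have := hR.charP_residueField hp
  have := Fact.mk hp
  simp only [Nat.add_sub_cancel]
  refine ⟨?_, ?_, ?_, ?_, ?_, ?_, ?_, ?_, ?_⟩
  · intro C
    rcases hR.exists_generators hp C with ⟨n, hn, hC⟩ | ⟨k, n, c, hk, hnk, hc, hC⟩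
    · rcases hn.eq_or_lt with rfl | hlt
      · left
        obtain ⟨G, -, hrel⟩ := hR.exists_xSubOne_pow_self hp t
        have hz : (p : CyclicAmbient R (p ^ (t + 1))) *
            xSubOne R (p ^ (t + 1)) ^ p ^ (t + 1) = 0 := by
          rw [hR.natCast_mul_ambient_eq_zero_iff hp (pow_ne_zero _ hp.ne_zero), map_pow,
            reduction_xSubOne, xSubOne_pow_eq_zero_iff]
        rw [hC, hz, Ideal.span_singleton_eq_bot]
      · exact Or.inr (Or.inr (Or.inl ⟨n, hlt, hC⟩))
    -- The unit ideal needs no separate treatment: it is the case k = 0 of ⟨u^k⟩.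
    · right; right; right
      -- When n = k, the second generator is p times the first.
      have hdrop : n = k → C = Ideal.span {xSubOne R (p ^ (t + 1)) ^ k +
          p * ∑ j ∈ Finset.range n, AdjoinRoot.of _ (c j) * xSubOne R (p ^ (t + 1)) ^ j} := by
        rintro rfl
        have hpp : (p : CyclicAmbient R (p ^ (t + 1))) * p = 0 := by
          rw [hR.natCast_mul_ambient_eq_zero_iff hp (pow_ne_zero _ hp.ne_zero),
            ← mul_one (p : CyclicAmbient R (p ^ (t + 1))), hR.reduction_natCast_mul]
        rw [hC, Ideal.span_insert, sup_eq_left, Ideal.span_singleton_le_span_singleton]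
        exact ⟨p, by rw [add_mul, mul_right_comm, hpp]; ring⟩
      rcases sum_eq_zero_or_exists_deltaPoly (p := p) (m := m) (N := p ^ (t + 1)) hnk hc with
        h0 | ⟨l, η, hη, hsum⟩
      · rw [h0, mul_zero, add_zero] at hC hdrop
        rcases hnk.eq_or_lt with he | hlt
        · exact Or.inl ⟨k, hk, hdrop he⟩
        · exact Or.inr (Or.inr (Or.inl ⟨k, n, hk, hlt, hC⟩))
      · rw [hsum, ← mul_assoc] at hC hdrop
        rcases hnk.eq_or_lt with he | hlt
        · exact Or.inr (Or.inl ⟨k, l, η, hk, hη, hdrop he⟩)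
        · exact Or.inr (Or.inr (Or.inr ⟨k, l, n, η, hk, hlt, hη, hC⟩))
  · exact fun C i _ => hR.torsionalDegree_spec hp i C
  · intro k hk C hC
    obtain ⟨h0, h1⟩ := hR.torsionalDegree_span_pair hp hk.le (hR.span_zero_relation hp t k)
      (hR.span_reduction_zero hp _) (C := C) (by
        rw [hC, mul_zero, add_zero, Ideal.span_insert, Ideal.span_singleton_eq_bot.2 rfl,
          sup_bot_eq])
    exact ⟨h0, by omega⟩
  · intro k l η hk hη C hC
    obtain ⟨h0, h1⟩ := hR.torsionalDegree_span_pair hp hk.le (hR.span_delta_relation hp hk hη)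
      (hR.span_reduction_zero hp _) (C := C) (by
        rw [hC, mul_zero, Ideal.span_insert, Ideal.span_singleton_eq_bot.2 rfl, sup_bot_eq,
          mul_assoc])
    refine ⟨h0, fun hne => ?_, fun he => ?_⟩
    · rw [if_neg hne] at h1; omega
    · rw [if_pos he] at h1; omega
  · intro k n hk hn C hC
    obtain ⟨h0, h1⟩ := hR.torsionalDegree_span_pair hp hk.le (hR.span_zero_relation hp t k)
      (span_reduction_xSubOne_pow n) (C := C) (by rw [hC, mul_zero, add_zero])
    exact ⟨h0, h1⟩
  · intro k l n η hk hn hη C hC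
    obtain ⟨h0, h1⟩ := hR.torsionalDegree_span_pair hp hk.le (hR.span_delta_relation hp hk hη)
      (span_reduction_xSubOne_pow n) (C := C) (by rw [hC, mul_assoc])
    refine ⟨h0, fun hne => ?_, fun he => ?_⟩
    · rw [if_neg hne] at h1; omega
    · rw [if_pos he] at h1; omega
  · exact fun n hn C hC => hR.torsionalDegree_span_natCast_mul hp hn.le hC
  · exact fun C _ => hR.hammingDistance_eq hp (pow_ne_zero _ hp.ne_zero)
      (hR.torsionalDegree_spec hp 1 C).2
  · rintro i d rfl
    refine ⟨?_, ?_, ?_, ?_⟩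
    · rintro rfl
      exact hammingDistance_span_zero
    · intro h1 h2
      exact hammingDistance_span_eq_add_two (b := 0) hp.one_lt (by omega) (by omega)
    · intro β hβ1 hβ2 h1 h2
      exact hammingDistance_span_eq_add_two (by have := hp.two_le; omega) h1 h2
    · intro τ k hτ1 hτ2 hk1 hk2 h1 h2
      -- With τ = b + 1 and s = r + 1 + k, this is block b of level k.
      obtain ⟨b, rfl⟩ := Nat.exists_eq_add_of_le' hτ1
      obtain ⟨r, rfl⟩ := Nat.exists_eq_add_of_le' hk2
      rw [show r + k + 1 - k = r + 1 by omega, Nat.add_sub_cancel, Nat.add_sub_cancel] at h1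
      rw [show r + k + 1 - k = r + 1 by omega, Nat.add_sub_cancel] at h2
      rw [show r + k + 1 = r + 1 + k by omega] at h1 h2 ⊢
      exact hammingDistance_span_eq_mul_pow (by have := hp.two_le; omega) h1 h2
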